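/- **Setting.** A *symmetric space* on $[0,1]$ is a Banach space $X$ of (classes of a.e. equal) Lebesgue measurable functions on $[0,1]$ such that (i) $|f|\le|g|$ a.e. and $g\in X$ imply $f\in X$ and $\|f\|_X\le\|g\|_X$; (ii) if $f\in X$ and $|f|,|g|$ are equimeasurable, then $g\in X$ and $\|g\|_X=\|f\|_X$. Its *fundamental function* is $\varphi(t)=\|\chi_{[0,t]}\|_X$, $t\in[0,1]$, and we put $$\alpha_\varphi=\liminf_{t\to0+}\frac{\varphi(2t)}{\varphi(t)},\qquad \beta_\varphi=\limsup_{t\to0+}\frac{\varphi(2t)}{\varphi(t)}.$$ Let $X(\varphi_1),\dots,X(\varphi_m)$ be symmetric spaces on $[0,1]$ with fundamental functions $\varphi_1,\dots,\varphi_m$. For a Lebesgue measurable $f$ on $\mathbb R^m$, $2\pi$-periodic in each variable, let $f^{*_1,\dots,*_m}$ be obtained from $|f(2\pi\bar x)|$, $\bar x\in[0,1]^m$, by taking the nonincreasing rearrangement in $x_1$ (the other variables being fixed), then in $x_2$, …, then in $x_m$. The anisotropic symmetric space $X(\bar\varphi)$ consists of all $f$ with $$\|f\|^*_{X(\bar\varphi)}=\big\|\dots\|f^{*_1,\dots,*_m}\|_{X(\varphi_1)}\dots\big\|_{X(\varphi_m)}<\infty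 ,$$ the norm of $X(\varphi_j)$ being taken in the $j$-th variable. Let $a_{\bar k}(f)$ be the Fourier coefficients of $f$ and, for $\bar s\in\mathbb Z_+^m$, $$\delta_{\bar s}(f,\bar x)=\sum_{\bar k\in\rho(\bar s)}a_{\bar k}(f)e^{i\langle\bar k,\bar x\rangle},\qquad \rho(\bar s)=\{\bar k\in\mathbb Z^m:\ 2^{s_j-1}\le|k_j|<2^{s_j},\ j=1,\dots,m\}.$$ For $e\subset\{1,\dots,m\}$ and $\bar n\in\mathbb N^m$ ($\mathbb N=\{1,2,\dots\}$) let $$G_e(\bar n)=\{\bar s\in\mathbb N^m:\ s_j\le n_j\ (j\in e),\ s_j>n_j\ (j\notin e)\},$$ and let $$\bar f(\bar t)=\sup_{|E_m|\ge t_m}\frac1{|E_m|}\int_{E_m}\dots\sup_{|E_1|\ge t_1}\frac1{|E_1|}\int_{E_1}|f(x_1,\dots,x_m)|\,dx_1\dots dx_m ,$$ where $E_j$ runs over the measurable subsets of $[0,2\pi)$ and $|E_j|$ is the Lebesgue measure (the supremum over $E_j$ is taken for fixed $x_{j+1},\dots,x_m$). **Theorem 1.** Let $1<\alpha_{\varphi_j}\le\beta_{\varphi_j}<2$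 for $j=1,\dots,m$. There is a constant $C>0$, depending only on $m$ and $\varphi_1,\dots,\varphi_m$, such that for every $f\in X(\bar\varphi)$ with $\int_0^{2\pi}f(\bar x)\,dx_j=0$, $j=1,\dots,m$ (for almost all values of the other variables), all $n_1,\dots,n_m\in\mathbb N$ and all $\bar t\in\prod_{j=1}^m(2^{-n_j-1},2^{-n_j}]$, $$\bar f(\bar t)\le C\Big\{\prod_{j=1}^m\frac1{\varphi_j(t_j)}\sum_{s_m=n_m+1}^\infty\dots\sum_{s_1=n_1+1}^\infty\|\delta_{\bar s}(f)\|^*_{X(\bar\varphi)}+\sum_{e\subset\{1,\dots,m\}}\ \prod_{j\notin e}\frac1{\varphi_j(t_j)}\sum_{\bar s\in G_e(\bar n)}\ \prod_{j\in e}\frac1{\varphi_j(2^{-s_j})}\,\|\delta_{\bar s}(f)\|^*_{X(\bar\varphi)}\Big\},$$ and also $$\bar f(\bar t)\le C\Big\{\prod_{j=1}^m\frac1{\varphi_j(t_j)}\sum_{s_m=n_m+1}^\infty\dots\sum_{s_1=n_1+1}^\infty\|\delta_{\bar s}(f)\|^*_{X(\bar\varphi)}+\sum_{e\subset\{1,\dots,m\}}\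 \prod_{j\notin e}\frac1{\varphi_j(t_j)}\sum_{\bar s\in G_e(\bar n)}\ \prod_{j\in e}\frac1{\varphi_j(2^{-n_j})}\,\|\delta_{\bar s}(f)\|^*_{X(\bar\varphi)}\Big\}.$$ (The right-hand sides may be $+\infty$.) -/

import Mathlib

open MeasureTheory Set Filter Topology
open scoped NNReal ENNReal

noncomputable section

/-- Lebesgue measure on the segment `[0, 1]`. -/
def unitMeasure : Measure ℝ := volume.restrict (Icc (0 : ℝ) 1)

/-- A symmetric (rearrangement invariant) Banach space of Lebesgue measurable functions on `[0, 1]`: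
a Banach space of classes of a.e. equal measurable functions whose norm is monotone in the modulus
and depends only on the distribution of the modulus. -/
structure SymmetricSpace where
  /-- the functions that belong to the space -/
  space : Submodule ℝ (ℝ →ₘ[unitMeasure] ℝ)
  /-- the norm -/
  nrm : Seminorm ℝ space
  eq_zero_of_nrm : ∀ f : space, nrm f = 0 → f = 0
  complete : ∀ u : ℕ → space,
    (∀ ε : ℝ, 0 < ε → ∃ N, ∀ k ≥ N, ∀ l ≥ N, nrm (u k - u l) < ε) →
    ∃ f : space, Tendsto (fun k => nrm (u k - f)) atTop (𝓝 0)
  solid : ∀ (g : space) (f : ℝ →ₘ[unitMeasure] ℝ),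
    (∀ᵐ x ∂unitMeasure, |f x| ≤ |g.1 x|) → ∃ hf : f ∈ space, nrm ⟨f, hf⟩ ≤ nrm g
  symmetric : ∀ (f : space) (g : ℝ →ₘ[unitMeasure] ℝ),
    (∀ r : ℝ, 0 < r → unitMeasure {x | r < |f.1 x|} = unitMeasure {x | r < |g x|}) →
    ∃ hg : g ∈ space, nrm ⟨g, hg⟩ = nrm f

/-- The norm of a function `g : [0, 1] → [0, ∞]`: it is the norm of any member `F` of the space with
`|F| = g` almost everywhere (all of them have the same norm), and `∞` if there is none. -/
def SymmetricSpace.extNorm (X : SymmetricSpace) (g : ℝ → ℝ≥0∞) : ℝ≥0∞ :=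
  ⨅ (F : X.space) (_ : ∀ᵐ x ∂unitMeasure, g x = ‖F.1 x‖ₑ), ENNReal.ofReal (X.nrm F)

/-- `φ` is the fundamental function of `X`: `φ t = ‖χ_{[0, t]}‖_X` for `t ∈ [0, 1]`. -/
def SymmetricSpace.HasFundamentalFunction (X : SymmetricSpace) (φ : ℝ → ℝ≥0) : Prop :=
  ∀ t ∈ Icc (0 : ℝ) 1, X.extNorm ((Icc (0 : ℝ) t).indicator 1) = φ t

/-- The lower dilation limit `liminf φ(2t) / φ(t)` as `t → 0+`. -/
def lowerDilation (φ : ℝ → ℝ≥0) : ℝ≥0∞ :=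
  liminf (fun t : ℝ => ((φ (2 * t) / φ t : ℝ≥0) : ℝ≥0∞)) (𝓝[>] 0)

/-- The upper dilation limit `limsup φ(2t) / φ(t)` as `t → 0+`. -/
def upperDilation (φ : ℝ → ℝ≥0) : ℝ≥0∞ :=
  limsup (fun t : ℝ => ((φ (2 * t) / φ t : ℝ≥0) : ℝ≥0∞)) (𝓝[>] 0)

/-- The nonincreasing rearrangement of `g : [0, 1] → [0, ∞]`. -/
def decRearr (g : ℝ → ℝ≥0∞) (t : ℝ) : ℝ≥0∞ :=
  sInf {r : ℝ≥0∞ | unitMeasure {u | r < g u} < ENNReal.ofReal t}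

variable {m : ℕ}

/-- The iterated rearrangement `F^{*_1,…,*_m}`: rearrange in the first variable with the others
fixed, then in the second one, and so on. -/
def iterRearr (F : (Fin m → ℝ) → ℝ≥0∞) : (Fin m → ℝ) → ℝ≥0∞ :=
  (List.finRange m).foldl
    (fun G j x => decRearr (fun u => G (Function.update x j u)) (x j)) F

/-- The iterated norm `‖…‖G‖_{X_1}…‖_{X_m}`: the norm of `X_1` is taken in the first variable with
the others fixed, then the norm of `X_2` in the second one, and so on. (After the last step the
function is constant.) -/
def iterNorm (X : Fin m → SymmetricSpace) (G : (Fin m → ℝ) → ℝ≥0∞) : ℝ≥0∞ :=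
  (List.finRange m).foldl
    (fun H j x => (X j).extNorm (fun u => H (Function.update x j u))) G 0

/-- The anisotropic norm `‖f‖*` of a function of period `2π` in each variable. -/
def anisoNorm (X : Fin m → SymmetricSpace) (f : (Fin m → ℝ) → ℂ) : ℝ≥0∞ :=
  iterNorm X (iterRearr fun x => ‖f fun i => 2 * Real.pi * x i‖ₑ)

/-- Membership in the anisotropic symmetric space: `f` is Lebesgue measurable, has period `2π` in
each variable, and its anisotropic norm is finite. -/
structure MemAniso (X : Fin m → SymmetricSpace) (f : (Fin m → ℝ) → ℂ) : Prop where
  aestronglyMeasurable : AEStronglyMeasurable f volume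
  periodic : ∀ (j : Fin m) (x : Fin m → ℝ),
    f (Function.update x j (x j + 2 * Real.pi)) = f x
  anisoNorm_lt_top : anisoNorm X f < ∞

/-- Mean value zero in each variable: `∫_0^{2π} f dx_j = 0` for every `j`, for almost all values of
the other variables. -/
def HasZeroMeans (f : (Fin m → ℝ) → ℂ) : Prop :=
  ∀ j : Fin m, ∀ᵐ x : Fin m → ℝ, ∫ u in (0 : ℝ)..(2 * Real.pi), f (Function.update x j u) = 0

/-- The character `e^{i⟨k, x⟩}`. -/
def character (k : Fin m → ℤ) (x : Fin m → ℝ) : ℂ :=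
  Complex.exp (Complex.I * ((∑ j, (k j : ℝ) * x j : ℝ) : ℂ))

/-- The Fourier coefficient of `f` with respect to `e^{i⟨k, x⟩}`. -/
def fourierCoef (f : (Fin m → ℝ) → ℂ) (k : Fin m → ℤ) : ℂ :=
  ((2 * Real.pi : ℝ) : ℂ)⁻¹ ^ m *
    ∫ x in Set.univ.pi fun _ : Fin m => Ico (0 : ℝ) (2 * Real.pi), f x * character (-k) x

/-- The dyadic block of frequencies `{k ∈ ℤ^m : 2^{s_j - 1} ≤ |k_j| < 2^{s_j}, j = 1, …, m}`. -/
def freqBlock (s : Fin m → ℕ) : Finset (Fin m → ℤ) :=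
  Fintype.piFinset fun j =>
    (Finset.Ioo (-(2 ^ s j : ℤ)) (2 ^ s j)).filter fun k => (2 : ℤ) ^ s j ≤ 2 * |k|

/-- The dyadic block `δ_s(f, x)` of the Fourier series of `f`. -/
def dyadicBlock (f : (Fin m → ℝ) → ℂ) (s : Fin m → ℕ) (x : Fin m → ℝ) : ℂ :=
  ∑ k ∈ freqBlock s, fourierCoef f k * character k x

/-- The index set `G_e(n)`. -/
def indexSet (e : Finset (Fin m)) (n : Fin m → ℕ) : Set (Fin m → ℕ) :=
  {s | (∀ j, 1 ≤ s j) ∧ (∀ j ∈ e, s j ≤ n j) ∧ ∀ j ∉ e, n j < s j}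

/-- The iterated sup-average function
`sup_{|E_m| ≥ t_m} |E_m|⁻¹ ∫_{E_m} … sup_{|E_1| ≥ t_1} |E_1|⁻¹ ∫_{E_1} |f| dx_1 … dx_m`,
with measurable `E_j ⊆ [0, 2π)`; the inner supremum is taken for fixed `x_2, …, x_m`. -/
def supAverage (f : (Fin m → ℝ) → ℂ) (t : Fin m → ℝ) : ℝ≥0∞ :=
  (List.finRange m).foldl
    (fun G j x => ⨆ (E : Set ℝ) (_ : MeasurableSet E) (_ : E ⊆ Ico 0 (2 * Real.pi))
      (_ : ENNReal.ofReal (t j) ≤ volume E),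
      (volume E)⁻¹ * ∫⁻ u in E, G (Function.update x j u))
    (fun x => ‖f x‖ₑ) 0

end

/-! Iterated suprema of averages over sets are replaced by the iterated functional `kAverage`, which
is essentially the K-functional between L¹ and L^∞. It dominates the averages over sets of measure
at least `t`. It is monotone and countably subadditive, and it preserves measurability in the
remaining variables, so it can be iterated. Since `f` has zero means, it is the sum of its dyadic
blocks whenever these are absolutely summable in the mean, so it suffices to bound one block `δ_s`
(`alongCoords_kAverage_le_tsum_dyadicBlock`).

Two facts give the bound for a block.

Weak type estimate. A nonincreasing `g` satisfies `φ(u) g(u) ≤ ‖g‖`; iterated, this bounds the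
iterated rearrangement of a function at `u` by its anisotropic norm over `∏ φ_j(u_j)`. A dyadic
layer decomposition gives `kAverage t g ≤ ∑ 4π 2^{-k} g*(2^{-k} t)`. When the upper dilation limit
is below 2, `1/φ(2^{-k} t)` grows more slowly than `2^k`. The sum then costs only a constant, and
the iterated `kAverage` is at most `C ∏ 1/φ_j(t_j)` times the norm
(`alongCoords_kAverage_le_anisoNorm`).

Nikol'skii type inequality. In the variable `x_j` the block `δ_s` has degree less than `N =
2^{s_j}`. A discrete reproducing kernel shows that its supremum in `x_j` is at most twice its
`kAverage` at `1/N` (`ReproducedAlong.le_two_mul_kAverage`). Hence `t_j` may be replaced by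
`2^{-s_j}` in any chosen set `e` of coordinates, at the cost of a factor 2 each.

Choosing `e = {j : s_j ≤ n_j}` for each `s` gives the first inequality. The second follows because
each `φ_j` is nondecreasing. -/

noncomputable section

/-! ### Functionals applied coordinate by coordinate -/

/-- Apply, for the coordinates `j` in the list `l` one after another, the functional `T j` to the
sections of `G` in the `j`-th variable. -/
def alongCoords {m : ℕ} (T : Fin m → (ℝ → ℝ≥0∞) → ℝ≥0∞) (l : List (Fin m))
    (G : (Fin m → ℝ) → ℝ≥0∞) : (Fin m → ℝ) → ℝ≥0∞ :=
  l.foldl (fun G j x => T j (fun u => G (Function.update x j u))) G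

section AlongCoords

variable {m : ℕ} {T T' : Fin m → (ℝ → ℝ≥0∞) → ℝ≥0∞}

@[simp] lemma alongCoords_nil (G : (Fin m → ℝ) → ℝ≥0∞) : alongCoords T [] G = G := rfl

lemma alongCoords_cons (j : Fin m) (l : List (Fin m)) (G : (Fin m → ℝ) → ℝ≥0∞) :
    alongCoords T (j :: l) G =
      alongCoords T l (fun x => T j (fun u => G (Function.update x j u))) := rfl

/-- The set `S` collects the coordinates already consumed, which makes the induction on `l` go
through. -/
lemma alongCoords_dependsOn (l : List (Fin m)) (G : (Fin m → ℝ) → ℝ≥0∞) (S : Set (Fin m))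
    (hG : ∀ x y : Fin m → ℝ, (∀ i ∉ S, x i = y i) → G x = G y) (x y : Fin m → ℝ)
    (h : ∀ i, i ∉ S → i ∉ l → x i = y i) : alongCoords T l G x = alongCoords T l G y := by
  induction l generalizing G S with
  | nil => exact hG x y fun i hi => h i hi (by simp)
  | cons j l ih =>
    rw [alongCoords_cons]
    refine ih _ (insert j S) ?_ ?_
    · intro x y hxy
      congr 1
      ext u
      refine hG _ _ fun i hi => ?_
      by_cases hij : i = j
      · subst hij; simp
      · simp only [Function.update_of_ne hij]
        exact hxy i (by simp [hij, hi])
    · intro i hi hil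
      simp only [Set.mem_insert_iff, not_or] at hi
      exact h i hi.2 (by simp [hi.1, hil])

lemma alongCoords_congr_off (l : List (Fin m)) (G : (Fin m → ℝ) → ℝ≥0∞) (x y : Fin m → ℝ)
    (h : ∀ i ∉ l, x i = y i) : alongCoords T l G x = alongCoords T l G y :=
  alongCoords_dependsOn l G ∅ (fun x y hxy => congrArg G (funext fun i => hxy i (by simp))) x y
    fun i _ hi => h i hi

lemma alongCoords_finRange_eq (G : (Fin m → ℝ) → ℝ≥0∞) (x y : Fin m → ℝ) :
    alongCoords T (List.finRange m) G x = alongCoords T (List.finRange m) G y :=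
  alongCoords_congr_off _ G x y fun i hi => absurd (List.mem_finRange i) hi

lemma alongCoords_mono (hT : ∀ j g h, g ≤ h → T j g ≤ T' j h) (l : List (Fin m))
    {G H : (Fin m → ℝ) → ℝ≥0∞} (hGH : G ≤ H) : alongCoords T l G ≤ alongCoords T' l H := by
  induction l generalizing G H with
  | nil => exact hGH
  | cons j l ih => exact ih fun x => hT j _ _ fun u => hGH _

lemma measurable_comp_update {G : (Fin m → ℝ) → ℝ≥0∞} (hG : Measurable G) (j : Fin m) :
    Measurable fun p : (Fin m → ℝ) × ℝ => G (Function.update p.1 j p.2) :=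
  hG.comp measurable_update'

lemma measurable_section {G : (Fin m → ℝ) → ℝ≥0∞} (hG : Measurable G) (j : Fin m)
    (x : Fin m → ℝ) : Measurable fun u => G (Function.update x j u) :=
  hG.comp (measurable_update x)

end AlongCoords

/-! ### Lebesgue measure on the box and its sections -/

/-- The product of the Lebesgue measures on `[0, 2π)`. -/
def boxMeasure (m : ℕ) : Measure (Fin m → ℝ) :=
  Measure.pi fun _ : Fin m => volume.restrict (Ico (0 : ℝ) (2 * Real.pi))

lemma boxMeasure_eq_restrict (m : ℕ) : boxMeasure m =
    volume.restrict (Set.univ.pi fun _ : Fin m => Ico (0 : ℝ) (2 * Real.pi)) := by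
  rw [boxMeasure, volume_pi, Measure.restrict_pi_pi]

instance (m : ℕ) : IsFiniteMeasure (boxMeasure m) := by
  unfold boxMeasure; infer_instance

/-- The inner integral no longer depends on `x j`, so the outer integration over `x j` contributes
only the length `2π`. -/
lemma lintegral_lintegral_update {m : ℕ} {F : (Fin m → ℝ) → ℝ≥0∞} (hF : Measurable F)
    (j : Fin m) :
    ∫⁻ x, (∫⁻ u in Ico (0 : ℝ) (2 * Real.pi), F (Function.update x j u)) ∂boxMeasure m =
      ENNReal.ofReal (2 * Real.pi) * ∫⁻ x, F x ∂boxMeasure m := by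
  set μ : Fin m → Measure ℝ := fun _ => volume.restrict (Ico (0 : ℝ) (2 * Real.pi)) with hμ
  set g : (Fin m → ℝ) → ℝ≥0∞ := fun x => ∫⁻ u, F (Function.update x j u) ∂μ j with hg
  have hgm : Measurable g := (measurable_comp_update hF j).lintegral_prod_right'
  have h0 : ∀ x, lmarginal μ (Finset.univ.erase j) g x = ∫⁻ x, F x ∂boxMeasure m := by
    intro x
    rw [← lmarginal_erase' F hF (Finset.mem_univ j), lmarginal_univ]
    rfl
  change ∫⁻ x, g x ∂Measure.pi μ = _
  rw [lintegral_eq_lmarginal_univ (0 : Fin m → ℝ), lmarginal_erase g hgm (Finset.mem_univ j)]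
  simp_rw [h0]
  simp only [lintegral_const, hμ, Measure.restrict_apply_univ, Real.volume_Ico, sub_zero]
  rw [mul_comm]

lemma ae_ae_update {m : ℕ} {p : (Fin m → ℝ) → Prop} (h : ∀ᵐ x ∂boxMeasure m, p x) (j : Fin m) :
    ∀ᵐ x ∂boxMeasure m, ∀ᵐ u ∂volume.restrict (Ico (0 : ℝ) (2 * Real.pi)),
      p (Function.update x j u) := by
  set N := toMeasurable (boxMeasure m) {x | ¬ p x} with hN
  have hNm : MeasurableSet N := measurableSet_toMeasurable _ _
  have hN0 : boxMeasure m N = 0 := by rw [hN, measure_toMeasurable]; exact h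
  have hFm : Measurable (N.indicator (1 : (Fin m → ℝ) → ℝ≥0∞)) := measurable_one.indicator hNm
  have h1 := lintegral_lintegral_update hFm j
  rw [lintegral_indicator_one hNm, hN0, mul_zero, lintegral_eq_zero_iff
    (measurable_comp_update hFm j).lintegral_prod_right'] at h1
  filter_upwards [h1] with x hx
  rw [Pi.zero_apply, lintegral_eq_zero_iff (measurable_section hFm j x)] at hx
  filter_upwards [hx] with u hu
  by_contra hp
  have : Function.update x j u ∈ N := subset_toMeasurable _ _ hp
  simp [this] at hu

/-- Exceptional null sets have null sections almost everywhere, so the inequality survives each step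
almost everywhere. After the last step both sides are constant, and one good point suffices. -/
lemma alongCoords_ae_mono {m : ℕ} {T : Fin m → (ℝ → ℝ≥0∞) → ℝ≥0∞}
    (hT : ∀ j g h, (∀ᵐ u ∂volume.restrict (Ico (0 : ℝ) (2 * Real.pi)), g u ≤ h u) → T j g ≤ T j h)
    {G H : (Fin m → ℝ) → ℝ≥0∞} (hGH : ∀ᵐ x ∂boxMeasure m, G x ≤ H x) (x : Fin m → ℝ) :
    alongCoords T (List.finRange m) G x ≤ alongCoords T (List.finRange m) H x := by
  have key : ∀ l : List (Fin m), ∀ G H : (Fin m → ℝ) → ℝ≥0∞, (∀ᵐ x ∂boxMeasure m, G x ≤ H x) →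
      ∀ᵐ x ∂boxMeasure m, alongCoords T l G x ≤ alongCoords T l H x := by
    intro l
    induction l with
    | nil => exact fun G H h => h
    | cons j l ih =>
      intro G H h
      refine ih _ _ ?_
      filter_upwards [ae_ae_update h j] with x hx using hT j _ _ hx
  have hne : boxMeasure m ≠ 0 := by
    intro h0
    have := congrArg (fun μ => μ Set.univ) h0
    simp only [boxMeasure, Measure.pi_univ, Measure.restrict_apply_univ, Real.volume_Ico] at this
    simp [Real.pi_pos.not_ge] at this
  have : (ae (boxMeasure m)).NeBot := ae_neBot.2 hne
  obtain ⟨y, hy⟩ := (key _ G H hGH).exists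
  rwa [alongCoords_finRange_eq G x y, alongCoords_finRange_eq H x y]

/-! ### The K-functional between integrable and bounded functions -/

/-- The functional `inf_{c ≥ 0} (c + t⁻¹ ‖(g - c)₊‖_1)`, up to a factor the `K`-functional of `g`
between the integrable and the bounded functions. -/
def kAverage (t : ℝ) (g : ℝ → ℝ≥0∞) : ℝ≥0∞ :=
  ⨅ c : ℚ, ENNReal.ofReal c +
    (ENNReal.ofReal t)⁻¹ * ∫⁻ u in Ico 0 (2 * Real.pi), (g u - ENNReal.ofReal c)

section KAverage

variable {t : ℝ}

/-- The levels in `kAverage` are rational so that the infimum is countable and measurability in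
parameters is immediate. Approximation from above recovers every level in `[0, ∞]`. -/
lemma kAverage_le (t : ℝ) (g : ℝ → ℝ≥0∞) (c : ℝ≥0∞) :
    kAverage t g ≤ c + (ENNReal.ofReal t)⁻¹ * ∫⁻ u in Ico 0 (2 * Real.pi), (g u - c) := by
  by_cases hc : c = ∞
  · simp [hc]
  refine ENNReal.le_of_forall_pos_le_add fun ε hε _ => ?_
  obtain ⟨q, hq1, hq2⟩ := exists_rat_btwn (show c.toReal < c.toReal + ε by simpa using hε)
  have h1 : c ≤ ENNReal.ofReal q := by
    rw [← ENNReal.ofReal_toReal hc]; exact ENNReal.ofReal_le_ofReal hq1.le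
  have h2 : ENNReal.ofReal q ≤ c + ε := by
    calc ENNReal.ofReal q ≤ ENNReal.ofReal (c.toReal + ε) := ENNReal.ofReal_le_ofReal hq2.le
      _ = c + ε := by
        rw [ENNReal.ofReal_add ENNReal.toReal_nonneg ε.coe_nonneg, ENNReal.ofReal_toReal hc,
          ENNReal.ofReal_coe_nnreal]
  calc kAverage t g ≤ _ := iInf_le _ q
    _ ≤ (c + ε) + (ENNReal.ofReal t)⁻¹ * ∫⁻ u in Ico 0 (2 * Real.pi), (g u - c) := by
      gcongr
    _ = _ := by ring

lemma le_kAverage {g : ℝ → ℝ≥0∞} {a : ℝ≥0∞}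
    (h : ∀ c : ℝ≥0∞, a ≤ c + (ENNReal.ofReal t)⁻¹ * ∫⁻ u in Ico 0 (2 * Real.pi), (g u - c)) :
    a ≤ kAverage t g :=
  le_iInf fun q => h (ENNReal.ofReal q)

lemma kAverage_ae_mono {g h : ℝ → ℝ≥0∞}
    (hgh : ∀ᵐ u ∂volume.restrict (Ico (0 : ℝ) (2 * Real.pi)), g u ≤ h u) :
    kAverage t g ≤ kAverage t h := by
  refine iInf_mono fun q => add_le_add le_rfl (mul_le_mul' le_rfl (lintegral_mono_ae ?_))
  filter_upwards [hgh] with u hu using tsub_le_tsub_right hu _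

lemma kAverage_mono {g h : ℝ → ℝ≥0∞} (hgh : g ≤ h) : kAverage t g ≤ kAverage t h :=
  kAverage_ae_mono (Eventually.of_forall hgh)

lemma kAverage_le_of_le {g : ℝ → ℝ≥0∞} {a : ℝ≥0∞} (h : ∀ u, g u ≤ a) : kAverage t g ≤ a := by
  refine (kAverage_le t g a).trans ?_
  simp [tsub_eq_zero_of_le (h _)]

lemma measurable_kAverage_section {m : ℕ} {G : (Fin m → ℝ) → ℝ≥0∞} (hG : Measurable G)
    (t : ℝ) (j : Fin m) : Measurable fun x => kAverage t (fun u => G (Function.update x j u)) := by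
  refine Measurable.iInf fun q => Measurable.const_add (Measurable.const_mul ?_ _) _
  exact ((measurable_comp_update hG j).sub measurable_const).lintegral_prod_right'

/-- Nearly optimal levels `c i` for the summands add up to a level for the sum, because `(∑ g_i - ∑
c_i)₊ ≤ ∑ (g_i - c_i)₊`. -/
lemma kAverage_tsum_le {ι : Type*} [Countable ι] {g : ι → ℝ → ℝ≥0∞}
    (hg : ∀ i, Measurable (g i)) :
    kAverage t (fun u => ∑' i, g i u) ≤ ∑' i, kAverage t (g i) := by
  refine ENNReal.le_of_forall_pos_le_add fun ε hε hfin => ?_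
  obtain ⟨δ, hδ, hδs⟩ := ENNReal.exists_pos_sum_of_countable' (ENNReal.coe_pos.2 hε).ne' ι
  have hex : ∀ i, ∃ c : ℚ, ENNReal.ofReal c + (ENNReal.ofReal t)⁻¹ *
      ∫⁻ u in Ico 0 (2 * Real.pi), (g i u - ENNReal.ofReal c) < kAverage t (g i) + δ i := by
    intro i
    refine iInf_lt_iff.1 (?_ : kAverage t (g i) < _)
    exact ENNReal.lt_add_right (ENNReal.ne_top_of_tsum_ne_top hfin.ne i) (hδ i).ne'
  choose c hc using hex
  refine (kAverage_le t _ (∑' i, ENNReal.ofReal (c i))).trans ?_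
  calc _ ≤ ∑' i, ENNReal.ofReal (c i) + (ENNReal.ofReal t)⁻¹ *
        ∫⁻ u in Ico 0 (2 * Real.pi), ∑' i, (g i u - ENNReal.ofReal (c i)) := by
        gcongr with u
        rw [tsub_le_iff_right, ← ENNReal.tsum_add]
        exact ENNReal.tsum_le_tsum fun i => le_tsub_add
    _ = ∑' i, (ENNReal.ofReal (c i) + (ENNReal.ofReal t)⁻¹ *
        ∫⁻ u in Ico 0 (2 * Real.pi), (g i u - ENNReal.ofReal (c i))) := by
        rw [lintegral_tsum fun i => ((hg i).sub_const _).aemeasurable,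
          ENNReal.tsum_add, ENNReal.tsum_mul_left]
    _ ≤ ∑' i, (kAverage t (g i) + δ i) := ENNReal.tsum_le_tsum fun i => (hc i).le
    _ ≤ ∑' i, kAverage t (g i) + ε := by
        rw [ENNReal.tsum_add]; gcongr

lemma kAverage_const_mul_le {a : ℝ≥0∞} (ha : a ≠ ∞) {g : ℝ → ℝ≥0∞} (hg : Measurable g) :
    kAverage t (fun u => a * g u) ≤ a * kAverage t g := by
  rw [kAverage.eq_def t g, ENNReal.mul_iInf fun h => absurd h ha]
  refine le_iInf fun q => (kAverage_le t _ (a * ENNReal.ofReal q)).trans (le_of_eq ?_)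
  simp_rw [← ENNReal.mul_sub fun _ _ => ha]
  rw [lintegral_const_mul _ (hg.sub_const _)]
  ring

/-- The averages over large sets are dominated by `kAverage`. -/
lemma iSup_average_le_kAverage (ht : 0 < t) (g : ℝ → ℝ≥0∞) :
    (⨆ (E : Set ℝ) (_ : MeasurableSet E) (_ : E ⊆ Ico 0 (2 * Real.pi))
      (_ : ENNReal.ofReal t ≤ volume E), (volume E)⁻¹ * ∫⁻ u in E, g u) ≤ kAverage t g := by
  refine iSup_le fun E => iSup_le fun _ => iSup_le fun hEs => iSup_le fun htE =>
    le_kAverage fun c => ?_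
  have h0 : volume E ≠ 0 := ((ENNReal.ofReal_pos.2 ht).trans_le htE).ne'
  have hT : volume E ≠ ∞ := measure_ne_top_of_subset hEs measure_Ico_lt_top.ne
  calc (volume E)⁻¹ * ∫⁻ u in E, g u ≤ (volume E)⁻¹ * ∫⁻ u in E, (c + (g u - c)) := by
        gcongr; exact le_add_tsub
    _ = (volume E)⁻¹ * (c * volume E) + (volume E)⁻¹ * ∫⁻ u in E, (g u - c) := by
        rw [lintegral_add_left measurable_const, setLIntegral_const, mul_add]
    _ ≤ c + (ENNReal.ofReal t)⁻¹ * ∫⁻ u in Ico 0 (2 * Real.pi), (g u - c) := by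
        gcongr ?_ + ?_ * ?_
        · rw [mul_comm c, ← mul_assoc, ENNReal.inv_mul_cancel h0 hT, one_mul]
        · exact ENNReal.inv_le_inv.2 htE
        · exact lintegral_mono_set hEs

lemma lintegral_le_kAverage (ht : 0 < t) (ht' : t ≤ 2 * Real.pi) (g : ℝ → ℝ≥0∞) :
    (ENNReal.ofReal (2 * Real.pi))⁻¹ * ∫⁻ u in Ico 0 (2 * Real.pi), g u ≤ kAverage t g := by
  refine le_trans ?_ (iSup_average_le_kAverage ht g)
  refine le_iSup_of_le (Ico 0 (2 * Real.pi)) (le_iSup_of_le measurableSet_Ico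
    (le_iSup_of_le subset_rfl (le_iSup_of_le ?_ ?_)))
  · simpa using ENNReal.ofReal_le_ofReal ht'
  · simp

lemma supAverage_le_kAverage {m : ℕ} (f : (Fin m → ℝ) → ℂ) {t : Fin m → ℝ} (ht : ∀ j, 0 < t j) :
    supAverage f t ≤ alongCoords (fun j => kAverage (t j)) (List.finRange m) (fun x => ‖f x‖ₑ) 0 :=
  alongCoords_mono (T := fun j g => ⨆ (E : Set ℝ) (_ : MeasurableSet E)
      (_ : E ⊆ Ico 0 (2 * Real.pi)) (_ : ENNReal.ofReal (t j) ≤ volume E),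
      (volume E)⁻¹ * ∫⁻ u in E, g u)
    (fun j _ _ hgh => (iSup_average_le_kAverage (ht j) _).trans (kAverage_mono hgh)) _ le_rfl 0

lemma alongCoords_kAverage_tsum_le {m : ℕ} (t : Fin m → ℝ) (l : List (Fin m))
    {ι : Type*} [Countable ι] {G : ι → (Fin m → ℝ) → ℝ≥0∞} (hG : ∀ i, Measurable (G i))
    (x : Fin m → ℝ) :
    alongCoords (fun j => kAverage (t j)) l (fun x => ∑' i, G i x) x ≤
      ∑' i, alongCoords (fun j => kAverage (t j)) l (G i) x := by
  induction l generalizing G with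
  | nil => exact le_rfl
  | cons j l ih =>
    refine le_trans ?_ (ih fun i => measurable_kAverage_section (hG i) (t j) j)
    exact alongCoords_mono (T := fun j => kAverage (t j)) (fun j _ _ => kAverage_mono) l
      (fun x => kAverage_tsum_le fun i => measurable_section (hG i) j x) x

lemma alongCoords_kAverage_const_mul_le {m : ℕ} (t : Fin m → ℝ) (l : List (Fin m))
    {a : ℝ≥0∞} (ha : a ≠ ∞) {G : (Fin m → ℝ) → ℝ≥0∞} (hG : Measurable G) (x : Fin m → ℝ) :
    alongCoords (fun j => kAverage (t j)) l (fun x => a * G x) x ≤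
      a * alongCoords (fun j => kAverage (t j)) l G x := by
  induction l generalizing G with
  | nil => exact le_rfl
  | cons j l ih =>
    refine le_trans ?_ (ih (measurable_kAverage_section hG (t j) j))
    exact alongCoords_mono (T := fun j => kAverage (t j)) (fun j _ _ => kAverage_mono) l
      (fun x => kAverage_const_mul_le ha (measurable_section hG j x)) x

/-- The mean of `G` over the box is at most its iterated `kAverage`. -/
lemma lintegral_boxMeasure_le {m : ℕ} {t : Fin m → ℝ} (ht : ∀ j, 0 < t j)
    (ht' : ∀ j, t j ≤ 2 * Real.pi) {G : (Fin m → ℝ) → ℝ≥0∞} (hG : Measurable G) :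
    (ENNReal.ofReal (2 * Real.pi))⁻¹ ^ m * ∫⁻ x, G x ∂boxMeasure m ≤
      alongCoords (fun j => kAverage (t j)) (List.finRange m) G 0 := by
  set a := (ENNReal.ofReal (2 * Real.pi))⁻¹ with ha
  have ha' : a ≠ ∞ := ENNReal.inv_ne_top.2 (by simp [Real.pi_pos])
  set μ : Fin m → Measure ℝ := fun _ => volume.restrict (Ico (0 : ℝ) (2 * Real.pi)) with hμ
  -- Tonelli in the form of `lmarginal`: each integration is normalized by `2π` and bounded by
  -- `kAverage` before the next one.
  have key : ∀ l : List (Fin m), l.Nodup → ∀ G : (Fin m → ℝ) → ℝ≥0∞, Measurable G → ∀ x,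
      a ^ l.length * lmarginal μ l.toFinset G x ≤
        alongCoords (fun j => kAverage (t j)) l G x := by
    intro l
    induction l with
    | nil => intro _ G _ x; simp
    | cons j l ih =>
      intro hl G hG x
      rw [List.nodup_cons] at hl
      have hm : Measurable fun x => ∫⁻ u, G (Function.update x j u) ∂μ j :=
        (measurable_comp_update hG j).lintegral_prod_right'
      rw [List.toFinset_cons, lmarginal_insert' G hG (by simpa using hl.1), List.length_cons]
      calc a ^ (l.length + 1) * lmarginal μ l.toFinset
              (fun x => ∫⁻ u, G (Function.update x j u) ∂μ j) x
          = a ^ l.length * lmarginal μ l.toFinset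
              (fun x => a * ∫⁻ u, G (Function.update x j u) ∂μ j) x := by
            rw [pow_succ, mul_assoc]
            congr 1
            simp only [lmarginal]
            exact (lintegral_const_mul _ (hm.comp measurable_updateFinset)).symm
        _ ≤ alongCoords (fun j => kAverage (t j)) l
              (fun x => a * ∫⁻ u, G (Function.update x j u) ∂μ j) x :=
            ih hl.2 _ (hm.const_mul a) x
        _ ≤ _ := alongCoords_mono (T := fun j => kAverage (t j)) (fun j _ _ => kAverage_mono) l
              (fun x => lintegral_le_kAverage (ht j) (ht' j) _) x
  have := key (List.finRange m) (List.nodup_finRange m) G hG 0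
  rwa [List.length_finRange, List.toFinset_finRange, lmarginal_univ] at this

end KAverage

/-! ### Rearrangements and dyadic layers -/

section Rearrangement

lemma decRearr_antitone (g : ℝ → ℝ≥0∞) : Antitone (decRearr g) := fun _ _ hst =>
  sInf_le_sInf fun _ hr => lt_of_lt_of_le hr (ENNReal.ofReal_le_ofReal hst)

lemma decRearr_ae_mono {g h : ℝ → ℝ≥0∞} (hgh : ∀ᵐ u ∂unitMeasure, g u ≤ h u) (t : ℝ) :
    decRearr g t ≤ decRearr h t := by
  refine sInf_le_sInf fun r hr => lt_of_le_of_lt (measure_mono_ae ?_) hr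
  filter_upwards [hgh] with u hu h using lt_of_lt_of_le h hu

lemma measure_lt_of_decRearr_lt {g : ℝ → ℝ≥0∞} {t : ℝ} {r : ℝ≥0∞} (h : decRearr g t < r) :
    unitMeasure {u | r < g u} < ENNReal.ofReal t := by
  obtain ⟨r0, hr0, hlt⟩ := sInf_lt_iff.1 h
  exact lt_of_le_of_lt (measure_mono fun u hu => hlt.trans hu) hr0

/-- The superlevel set at the infimum is the increasing union of those at levels decreasing to it;
in the limit the strict bound becomes a weak one. -/
lemma measure_decRearr_lt_le (g : ℝ → ℝ≥0∞) (t : ℝ) :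
    unitMeasure {u | decRearr g t < g u} ≤ ENNReal.ofReal t := by
  by_cases hR : decRearr g t = ∞
  · simp [hR]
  obtain ⟨a, ha, haR, hlim⟩ := exists_seq_strictAnti_tendsto' (lt_top_iff_ne_top.2 hR)
  have : {u | decRearr g t < g u} = ⋃ n, {u | a n < g u} := by
    ext u
    simp only [Set.mem_ofPred_eq, Set.mem_iUnion]
    refine ⟨fun h => ?_, fun ⟨n, hn⟩ => (haR n).1.trans hn⟩
    exact (hlim.eventually (gt_mem_nhds h)).exists
  have hmon : Monotone fun n => {u | a n < g u} := fun i j hij u hu =>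
    (ha.antitone hij).trans_lt hu
  rw [this, hmon.measure_iUnion]
  exact iSup_le fun n => (measure_lt_of_decRearr_lt (haR n).1).le

/-- The value at `t` of the rearrangement of `g`, a function on `[0, 2π]`, after rescaling to
`[0, 1]`. -/
def rearrAt (t : ℝ) (g : ℝ → ℝ≥0∞) : ℝ≥0∞ := decRearr (fun v => g (2 * Real.pi * v)) t

lemma volume_inter_Ico_le (A : Set ℝ) :
    volume (A ∩ Ico 0 (2 * Real.pi)) ≤
      ENNReal.ofReal (2 * Real.pi) * unitMeasure {v | 2 * Real.pi * v ∈ A} := by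
  have hpi : 0 < 2 * Real.pi := Real.two_pi_pos
  have h1 := Real.volume_preimage_mul_left hpi.ne' (A ∩ Ico 0 (2 * Real.pi))
  have h2 : volume (A ∩ Ico 0 (2 * Real.pi)) = ENNReal.ofReal (2 * Real.pi) *
      volume ((2 * Real.pi * ·) ⁻¹' (A ∩ Ico 0 (2 * Real.pi))) := by
    rw [h1, ← mul_assoc, ← ENNReal.ofReal_mul hpi.le, abs_of_pos (inv_pos.2 hpi),
      mul_inv_cancel₀ hpi.ne', ENNReal.ofReal_one, one_mul]
  rw [h2]
  refine mul_le_mul' le_rfl (le_trans (measure_mono ?_)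
    (Measure.le_restrict_apply (Icc 0 1) {v | 2 * Real.pi * v ∈ A}))
  rintro v ⟨hvA, hv0, hv1⟩
  refine ⟨hvA, ?_, ?_⟩
  · exact nonneg_of_mul_nonneg_right hv0 hpi
  · by_contra h
    push Not at h
    nlinarith

lemma ae_unitMeasure_of_ae {p : ℝ → Prop}
    (h : ∀ᵐ u ∂volume.restrict (Ico (0 : ℝ) (2 * Real.pi)), p u) :
    ∀ᵐ v ∂unitMeasure, p (2 * Real.pi * v) := by
  have hpi : 0 < 2 * Real.pi := Real.two_pi_pos
  rw [unitMeasure, ← Measure.restrict_congr_set (μ := volume) (Ico_ae_eq_Icc (a := (0 : ℝ)) (b := 1)),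
    ae_restrict_iff' measurableSet_Ico]
  rw [ae_restrict_iff' measurableSet_Ico] at h
  have h1 := Real.volume_preimage_mul_left hpi.ne' {u | ¬ (u ∈ Ico (0 : ℝ) (2 * Real.pi) → p u)}
  rw [show volume {u | ¬ (u ∈ Ico (0 : ℝ) (2 * Real.pi) → p u)} = 0 from h, mul_zero] at h1
  refine measure_mono_null (fun v hv => ?_) h1
  simp only [Set.mem_compl_iff, Set.mem_ofPred_eq, Set.mem_preimage, Classical.not_imp,
    Set.mem_Ico] at hv ⊢
  refine ⟨⟨by nlinarith [hv.1.1], by nlinarith [hv.1.2]⟩, hv.2⟩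

lemma rearrAt_ae_mono {g h : ℝ → ℝ≥0∞}
    (hgh : ∀ᵐ u ∂volume.restrict (Ico (0 : ℝ) (2 * Real.pi)), g u ≤ h u) (t : ℝ) :
    rearrAt t g ≤ rearrAt t h :=
  decRearr_ae_mono (ae_unitMeasure_of_ae hgh) t

lemma rearrAt_mono {g h : ℝ → ℝ≥0∞} (hgh : g ≤ h) (t : ℝ) : rearrAt t g ≤ rearrAt t h :=
  rearrAt_ae_mono (Eventually.of_forall hgh) t

lemma measurable_rearrAt_section {m : ℕ} {G : (Fin m → ℝ) → ℝ≥0∞} (hG : Measurable G)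
    (t : ℝ) (j : Fin m) : Measurable fun x => rearrAt t (fun u => G (Function.update x j u)) := by
  refine measurable_of_Iio fun a => ?_
  -- Rational levels suffice, so the sublevel set is a countable union of conditions on distribution
  -- functions, which are measurable in `x`.
  have : (fun x => rearrAt t (fun u => G (Function.update x j u))) ⁻¹' Iio a =
      ⋃ (q : ℚ) (_ : ENNReal.ofReal q < a), {x | unitMeasure
        {v | ENNReal.ofReal q < G (Function.update x j (2 * Real.pi * v))} <
          ENNReal.ofReal t} := by
    ext x
    simp only [Set.mem_preimage, Set.mem_Iio, Set.mem_iUnion, Set.mem_ofPred_eq, exists_prop]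
    constructor
    · intro h
      obtain ⟨q, _, hq1, hq2⟩ := ENNReal.lt_iff_exists_rat_btwn.1 h
      exact ⟨q, hq2, measure_lt_of_decRearr_lt hq1⟩
    · rintro ⟨q, hq, h⟩
      exact lt_of_le_of_lt (sInf_le h) hq
  rw [this]
  refine MeasurableSet.iUnion fun q => MeasurableSet.iUnion fun _ => ?_
  refine measurableSet_lt ?_ measurable_const
  have hm : Measurable fun p : (Fin m → ℝ) × ℝ =>
      G (Function.update p.1 j (2 * Real.pi * p.2)) :=
    (measurable_comp_update hG j).comp
      (measurable_fst.prodMk (measurable_snd.const_mul (2 * Real.pi)))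
  have : SFinite unitMeasure := by unfold unitMeasure; infer_instance
  exact measurable_measure_prodMk_left (measurableSet_lt measurable_const hm)

/-- Truncate at `r 0`. On the layer `r k < g ≤ r (k + 1)` the excess is at most `r (k + 1)`, and the
layer has measure at most `2π 2^{-k} t`. After the index shift the weight is `2π 2^{-k} = 4π
2^{-(k+1)}`. -/
lemma kAverage_le_tsum_rearrAt {t : ℝ} (ht : 0 < t) {g : ℝ → ℝ≥0∞} (hg : Measurable g) :
    kAverage t g ≤
      ∑' k : ℕ, ENNReal.ofReal (4 * Real.pi * (1 / 2) ^ k) * rearrAt ((1 / 2) ^ k * t) g := by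
  set r : ℕ → ℝ≥0∞ := fun k => rearrAt ((1 / 2) ^ k * t) g with hr
  have hset : ∀ k, volume.restrict (Ico 0 (2 * Real.pi)) {u | r k < g u} ≤
      ENNReal.ofReal (2 * Real.pi) * ENNReal.ofReal ((1 / 2) ^ k * t) := by
    intro k
    rw [Measure.restrict_apply (measurableSet_lt measurable_const hg)]
    refine (volume_inter_Ico_le _).trans ?_
    gcongr
    exact measure_decRearr_lt_le _ _
  have hnull : ∀ᵐ u ∂volume.restrict (Ico (0 : ℝ) (2 * Real.pi)), ∃ k, g u ≤ r k := by
    have hlim : Tendsto (fun k : ℕ => ENNReal.ofReal (2 * Real.pi) *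
        ENNReal.ofReal ((1 / 2) ^ k * t)) atTop (𝓝 0) := by
      have h1 : Tendsto (fun k : ℕ => ((1 : ℝ) / 2) ^ k * t) atTop (𝓝 0) := by
        simpa using (tendsto_pow_atTop_nhds_zero_of_lt_one (by norm_num : (0 : ℝ) ≤ 1 / 2)
          (by norm_num)).mul_const t
      have h2 := ENNReal.tendsto_ofReal h1
      have h3 := ENNReal.Tendsto.const_mul (a := ENNReal.ofReal (2 * Real.pi)) h2
        (Or.inr ENNReal.ofReal_ne_top)
      rwa [ENNReal.ofReal_zero, mul_zero] at h3
    refine le_antisymm (ge_of_tendsto' hlim fun k => (measure_mono fun u hu => ?_).trans (hset k))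
      zero_le
    simp only [Set.mem_compl_iff, Set.mem_ofPred_eq, not_exists, not_le] at hu
    exact hu k
  have hint : ∫⁻ u in Ico 0 (2 * Real.pi), (g u - r 0) ≤
      ∑' k : ℕ, r (k + 1) * (ENNReal.ofReal (2 * Real.pi) * ENNReal.ofReal ((1 / 2) ^ k * t)) := by
    calc _ ≤ ∫⁻ u in Ico 0 (2 * Real.pi), ∑' k : ℕ, {u | r k < g u}.indicator
          (fun _ => r (k + 1)) u := by
          refine lintegral_mono_ae ?_
          filter_upwards [hnull] with u hu
          classical
          -- The first `k` with `g u ≤ r k` identifies the layer of `u`; for `k = 0` there is no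
          -- excess.
          rcases hk : Nat.find hu with _ | k
          · have := Nat.find_spec hu
            rw [hk] at this
            simp [tsub_eq_zero_of_le this]
          · have h1 := Nat.find_spec hu
            have h2 := Nat.find_min hu (m := k) (by omega)
            rw [hk] at h1
            rw [not_le] at h2
            refine (tsub_le_self.trans h1).trans ?_
            refine le_trans (le_of_eq ?_) (ENNReal.le_tsum k)
            simp [Set.indicator, h2]
      _ = ∑' k : ℕ, r (k + 1) * volume.restrict (Ico 0 (2 * Real.pi)) {u | r k < g u} := by
          have hms : ∀ k, MeasurableSet {u | r k < g u} := fun k =>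
            measurableSet_lt measurable_const hg
          rw [lintegral_tsum fun k => (measurable_const.indicator (hms k)).aemeasurable]
          refine tsum_congr fun k => ?_
          rw [lintegral_indicator_const (hms k)]
      _ ≤ _ := by gcongr with k; exact hset k
  have hpi := Real.pi_gt_three
  calc kAverage t g ≤ r 0 + (ENNReal.ofReal t)⁻¹ * ∑' k : ℕ, r (k + 1) *
        (ENNReal.ofReal (2 * Real.pi) * ENNReal.ofReal ((1 / 2) ^ k * t)) := by
        refine (kAverage_le t g (r 0)).trans ?_
        gcongr
    _ = r 0 + ∑' k : ℕ, ENNReal.ofReal (4 * Real.pi * (1 / 2) ^ (k + 1)) * r (k + 1) := by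
        rw [← ENNReal.tsum_mul_left]
        congr 2
        ext k
        have : ENNReal.ofReal (2 * Real.pi) * ENNReal.ofReal ((1 / 2) ^ k * t) =
            ENNReal.ofReal t * ENNReal.ofReal (4 * Real.pi * (1 / 2) ^ (k + 1)) := by
          rw [← ENNReal.ofReal_mul Real.two_pi_pos.le, ← ENNReal.ofReal_mul ht.le]
          congr 1; ring
        rw [this, mul_left_comm, ← mul_assoc (ENNReal.ofReal t)⁻¹,
          ENNReal.inv_mul_cancel (ENNReal.ofReal_pos.2 ht).ne' ENNReal.ofReal_ne_top, one_mul,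
          mul_comm]
    _ ≤ _ := by
        rw [tsum_eq_zero_add' (f := fun k : ℕ =>
          ENNReal.ofReal (4 * Real.pi * (1 / 2) ^ k) * rearrAt ((1 / 2) ^ k * t) g)
          ENNReal.summable]
        gcongr
        refine le_mul_of_one_le_left' ?_
        rw [ENNReal.one_le_ofReal]
        norm_num; linarith

lemma alongCoords_congr {m : ℕ} {T T' : Fin m → (ℝ → ℝ≥0∞) → ℝ≥0∞} {l : List (Fin m)}
    (h : ∀ i ∈ l, T i = T' i) (G : (Fin m → ℝ) → ℝ≥0∞) :
    alongCoords T l G = alongCoords T' l G := by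
  induction l generalizing G with
  | nil => rfl
  | cons j l ih =>
    rw [alongCoords_cons, alongCoords_cons, h j (by simp)]
    exact ih (fun i hi => h i (by simp [hi])) _

/-- Each rearrangement is evaluated at a coordinate that no other step uses, so the evaluation
points can be fixed in advance. The induction peels off the last, outermost rearrangement. -/
lemma iterRearr_eq_alongCoords {m : ℕ} (G : (Fin m → ℝ) → ℝ≥0∞) (x : Fin m → ℝ) :
    iterRearr (fun x => G fun i => 2 * Real.pi * x i) x =
      alongCoords (fun j => rearrAt (x j)) (List.finRange m) G 0 := by
  have key : ∀ l : List (Fin m), l.Nodup → ∀ x : Fin m → ℝ,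
      l.foldl (fun G j x => decRearr (fun u => G (Function.update x j u)) (x j))
        (fun x => G fun i => 2 * Real.pi * x i) x =
      alongCoords (fun j => rearrAt (x j)) l G (fun i => 2 * Real.pi * x i) := by
    intro l
    induction l using List.reverseRecOn with
    | nil => intro _ x; rfl
    | append_singleton l j ih =>
      intro hl x
      rw [List.nodup_append_comm] at hl
      simp only [List.cons_append, List.nil_append, List.nodup_cons] at hl
      rw [alongCoords, List.foldl_append, List.foldl_append]
      simp only [List.foldl_cons, List.foldl_nil]
      rw [rearrAt]
      congr 1
      ext v
      rw [ih hl.2]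
      change _ = alongCoords (fun j => rearrAt (x j)) l G _
      rw [alongCoords_congr (T' := fun j => rearrAt (x j))]
      · congr 1
        ext i
        by_cases hij : i = j
        · subst hij; simp
        · simp [hij]
      · intro i hi
        have : i ≠ j := fun h => hl.1 (h ▸ hi)
        simp [this]
  rw [iterRearr, key _ (List.nodup_finRange m)]
  exact alongCoords_finRange_eq G _ _

lemma iterRearr_antitone {m : ℕ} (G : (Fin m → ℝ) → ℝ≥0∞) :
    Antitone (iterRearr fun x => G fun i => 2 * Real.pi * x i) := by
  intro x y hxy
  rw [iterRearr_eq_alongCoords, iterRearr_eq_alongCoords]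
  refine alongCoords_mono (fun j g h hgh => ?_) _ le_rfl 0
  exact (rearrAt_mono hgh _).trans (decRearr_antitone _ (hxy j))

end Rearrangement

/-! ### Weak type estimate in symmetric spaces -/

section SymmetricSpace

/-- If `h = |F|` almost everywhere, then `g` is finite almost everywhere, and solidity applies to
its real-valued version. Measurability of `g` is needed to form that class. -/
lemma SymmetricSpace.extNorm_mono (X : SymmetricSpace) {g h : ℝ → ℝ≥0∞}
    (hg : AEMeasurable g unitMeasure) (hgh : ∀ᵐ x ∂unitMeasure, g x ≤ h x) :
    X.extNorm g ≤ X.extNorm h := by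
  refine le_iInf fun F => le_iInf fun hF => ?_
  have hgF : ∀ᵐ x ∂unitMeasure, g x = ‖(g x).toReal‖ₑ := by
    filter_upwards [hgh, hF] with x hx hFx
    have : g x ≠ ∞ := (hx.trans_lt (by rw [hFx]; exact enorm_lt_top)).ne
    rw [Real.enorm_of_nonneg ENNReal.toReal_nonneg, ENNReal.ofReal_toReal this]
  let F' : ℝ →ₘ[unitMeasure] ℝ :=
    AEEqFun.mk (fun x => (g x).toReal) hg.ennreal_toReal.aestronglyMeasurable
  have hF' : ∀ᵐ x ∂unitMeasure, F' x = (g x).toReal := AEEqFun.coeFn_mk _ _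
  obtain ⟨hmem, hle⟩ := X.solid F F' (by
    filter_upwards [hgh, hF, hF'] with x hx hFx hFx'
    rw [hFx', ← Real.norm_eq_abs, ← Real.norm_eq_abs, ← toReal_enorm, ← toReal_enorm (F.1 x),
      ← hFx, Real.enorm_of_nonneg ENNReal.toReal_nonneg,
      ENNReal.toReal_ofReal ENNReal.toReal_nonneg]
    exact ENNReal.toReal_mono (by rw [hFx]; exact enorm_ne_top) hx)
  refine (iInf₂_le (⟨F', hmem⟩ : X.space) ?_).trans (ENNReal.ofReal_le_ofReal hle)
  filter_upwards [hgF, hF'] with x h1 h2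
  rw [h2]; exact h1

variable {X : SymmetricSpace} {φ : ℝ → ℝ≥0}

lemma SymmetricSpace.HasFundamentalFunction.monotoneOn (h : X.HasFundamentalFunction φ) :
    MonotoneOn φ (Icc 0 1) := by
  intro s hs t ht hst
  rw [← ENNReal.coe_le_coe, ← h s hs, ← h t ht]
  refine X.extNorm_mono (measurable_one.indicator measurableSet_Icc).aemeasurable
    (Eventually.of_forall fun x => ?_)
  exact Set.indicator_le_indicator_of_subset (Icc_subset_Icc_right hst) (fun _ => zero_le) x

/-- A nonincreasing function is dominated by the reciprocal of the fundamental function. -/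
lemma SymmetricSpace.HasFundamentalFunction.mul_le_extNorm (h : X.HasFundamentalFunction φ)
    {g : ℝ → ℝ≥0∞} (hg : Antitone g) {u : ℝ} (hu : u ∈ Ioc (0 : ℝ) 1) :
    φ u * g u ≤ X.extNorm g := by
  refine le_iInf fun F => le_iInf fun hF => ?_
  have hfin : X.extNorm ((Icc (0 : ℝ) u).indicator 1) < ∞ := by
    rw [h u ⟨hu.1.le, hu.2⟩]; exact ENNReal.coe_lt_top
  obtain ⟨K, hK'⟩ := iInf_lt_iff.1 hfin
  obtain ⟨hK, -⟩ := iInf_lt_iff.1 hK'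
  have hφK : (φ u : ℝ≥0∞) ≤ ENNReal.ofReal (X.nrm K) := by
    rw [← h u ⟨hu.1.le, hu.2⟩]; exact iInf₂_le K hK
  -- An infinite value at `u` would make `g` infinite on `[0, u]`, a set of positive measure,
  -- whereas `F` is real valued.
  have hgu : g u ≠ ∞ := by
    intro htop
    have : ∀ᵐ x ∂unitMeasure, x ∉ Icc (0 : ℝ) u := by
      filter_upwards [hF] with x hx hxu
      have h1 : g u ≤ g x := hg hxu.2
      rw [htop, hx] at h1
      exact absurd (enorm_lt_top (x := F.1 x)) (not_lt.2 h1)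
    have h2 : unitMeasure (Icc (0 : ℝ) u) = 0 := by
      rw [ae_iff] at this
      simpa only [not_not, Set.ofPred_mem_eq] using this
    rw [unitMeasure, Measure.restrict_apply measurableSet_Icc,
      Set.inter_eq_left.2 (Icc_subset_Icc_right hu.2)] at h2
    simp [hu.1.not_ge] at h2
  set c := (g u).toReal with hc
  -- Here `|K|` is the indicator of `[0, u]`, and `g ≥ g u` there.
  have hcK : ∀ᵐ x ∂unitMeasure, |(c • K).1 x| ≤ |F.1 x| := by
    have hsm : ∀ᵐ x ∂unitMeasure, (c • K).1 x = c * K.1 x := AEEqFun.coeFn_smul c K.1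
    have hmem : ∀ᵐ x ∂unitMeasure, x ∈ Icc (0 : ℝ) 1 := ae_restrict_mem measurableSet_Icc
    filter_upwards [hF, hK, hsm, hmem] with x hFx hKx hx hx01
    rw [hx, abs_mul, abs_of_nonneg ENNReal.toReal_nonneg]
    by_cases hxu : x ≤ u
    · have h1 : x ∈ Icc (0 : ℝ) u := ⟨hx01.1, hxu⟩
      rw [Set.indicator_of_mem h1, Pi.one_apply] at hKx
      have h2 : |K.1 x| = 1 := by
        rw [← Real.norm_eq_abs, ← toReal_enorm, ← hKx, ENNReal.toReal_one]
      rw [h2, mul_one, ← Real.norm_eq_abs, ← toReal_enorm, ← hFx]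
      exact ENNReal.toReal_mono (by rw [hFx]; exact enorm_ne_top) (hg hxu)
    · rw [Set.indicator_of_notMem (fun h => hxu h.2)] at hKx
      have h2 : K.1 x = 0 := enorm_eq_zero.1 hKx.symm
      simp [h2]
  obtain ⟨_, hle⟩ := X.solid F (c • K).1 hcK
  have hle' : X.nrm (c • K) ≤ X.nrm F := hle
  rw [map_smul_eq_mul, Real.norm_of_nonneg ENNReal.toReal_nonneg] at hle'
  calc (φ u : ℝ≥0∞) * g u ≤ ENNReal.ofReal (X.nrm K) * ENNReal.ofReal c := by
        rw [hc, ENNReal.ofReal_toReal hgu]; gcongr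
    _ = ENNReal.ofReal (c * X.nrm K) := by
        rw [mul_comm, ENNReal.ofReal_mul ENNReal.toReal_nonneg]
    _ ≤ _ := ENNReal.ofReal_le_ofReal hle'

/-- A zero at `t` forces zeros on `(0, t)` by monotonicity. The quotients there are `0` by the
convention for division by zero, so the lower limit could not exceed 1. -/
lemma pos_of_one_lt_lowerDilation (hmono : MonotoneOn φ (Icc 0 1)) (h : 1 < lowerDilation φ)
    {t : ℝ} (ht : t ∈ Ioc (0 : ℝ) 1) : 0 < φ t := by
  by_contra h0
  have h0 : φ t = 0 := by simpa using h0
  have hev := eventually_lt_of_lt_liminf h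
  have hev2 : ∀ᶠ s : ℝ in 𝓝[>] 0, s ∈ Ioo (0 : ℝ) t := Ioo_mem_nhdsGT ht.1
  obtain ⟨s, hs, hs'⟩ := (hev.and hev2).exists
  have : φ s = 0 := by
    refine le_antisymm ?_ zero_le
    rw [← h0]
    exact hmono ⟨hs'.1.le, hs'.2.le.trans ht.2⟩ ⟨ht.1.le, ht.2⟩ hs'.2.le
  simp [this] at hs

/-- If the upper dilation limit is less than `2`, then `φ (t / 2 ^ k)` decreases slower than
`2 ^ (-k)`, uniformly in `t`. -/
lemma exists_dilation_bound (hmono : MonotoneOn φ (Icc 0 1)) (h1 : 1 < lowerDilation φ)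
    (h2 : upperDilation φ < 2) :
    ∃ q C : ℝ≥0, 1 ≤ q ∧ q < 2 ∧ ∀ t ∈ Ioc (0 : ℝ) 1, ∀ k : ℕ,
      φ t ≤ C * q ^ k * φ ((1 / 2) ^ k * t) := by
  obtain ⟨q0, hq0, hq02⟩ := ENNReal.lt_iff_exists_nnreal_btwn.1 h2
  have hq02' : q0 < 2 := by exact_mod_cast hq02
  set q := max q0 1 with hq
  have hev : ∀ᶠ t : ℝ in 𝓝[>] 0, ((φ (2 * t) / φ t : ℝ≥0) : ℝ≥0∞) < q0 :=
    eventually_lt_of_limsup_lt hq0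
  obtain ⟨δ, hδ, hδq⟩ := mem_nhdsGT_iff_exists_Ioo_subset.1 hev
  have hδ : 0 < δ := hδ
  set d := min δ 1 with hd
  have hd0 : d ∈ Ioc (0 : ℝ) 1 := ⟨lt_min hδ one_pos, min_le_right _ _⟩
  have hφd := pos_of_one_lt_lowerDilation hmono h1 hd0
  have hφ1 : φ d ≤ φ 1 := hmono ⟨hd0.1.le, hd0.2⟩ ⟨zero_le_one, le_rfl⟩ hd0.2
  have hq1 : 1 ≤ q := le_max_right _ _
  refine ⟨q, φ 1 / φ d, hq1, max_lt hq02' one_lt_two, fun t ht k => ?_⟩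
  induction k with
  | zero =>
    have : 1 ≤ φ 1 / φ d := (one_le_div hφd).2 hφ1
    simpa using le_mul_of_one_le_left' this
  | succ k ih =>
    have hpk : 0 < ((1 : ℝ) / 2) ^ (k + 1) * t := mul_pos (by positivity) ht.1
    have hpk1 : ((1 : ℝ) / 2) ^ (k + 1) * t ≤ 1 :=
      mul_le_one₀ (pow_le_one₀ (by norm_num) (by norm_num)) ht.1.le ht.2
    -- Below `d` each halving costs at most a factor `q`. Above `d` the ratio of values of `φ` is at
    -- most `φ 1 / φ d`, and `q ≥ 1` keeps the bound valid.
    by_cases hlt : ((1 : ℝ) / 2) ^ (k + 1) * t < d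
    · have hstep := hδq ⟨hpk, hlt.trans_le (min_le_left _ _)⟩
      have hpos := pos_of_one_lt_lowerDilation hmono h1 ⟨hpk, hpk1⟩
      rw [Set.mem_ofPred_eq, ENNReal.coe_lt_coe, div_lt_iff₀ hpos,
        show 2 * (((1 : ℝ) / 2) ^ (k + 1) * t) = (1 / 2) ^ k * t by ring] at hstep
      calc φ t ≤ φ 1 / φ d * q ^ k * φ ((1 / 2) ^ k * t) := ih
        _ ≤ φ 1 / φ d * q ^ k * (q * φ ((1 / 2) ^ (k + 1) * t)) := by
          gcongr
          exact hstep.le.trans (mul_le_mul_left (le_max_left _ _) _)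
        _ = _ := by ring
    · push Not at hlt
      calc φ t ≤ φ 1 := hmono ⟨ht.1.le, ht.2⟩ ⟨zero_le_one, le_rfl⟩ ht.2
        _ = φ 1 / φ d * 1 * φ d := by field_simp
        _ ≤ _ := by
          gcongr
          · exact one_le_pow₀ hq1
          · exact hmono ⟨hd0.1.le, hd0.2⟩ ⟨hpk.le, hpk1⟩ hlt

/-- The terms are dominated by a geometric series of ratio `q / 2 < 1`; this is what the bound on
the upper dilation limit is for. -/
lemma exists_tsum_inv_bound (hmono : MonotoneOn φ (Icc 0 1)) (h1 : 1 < lowerDilation φ)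
    (h2 : upperDilation φ < 2) :
    ∃ A : ℝ≥0, ∀ t ∈ Ioc (0 : ℝ) 1,
      ∑' k : ℕ, ENNReal.ofReal (4 * Real.pi * (1 / 2) ^ k) * (φ ((1 / 2) ^ k * t) : ℝ≥0∞)⁻¹ ≤
        A * (φ t : ℝ≥0∞)⁻¹ := by
  obtain ⟨q, C, hq1, hq2, h⟩ := exists_dilation_bound hmono h1 h2
  have hsum : ∑' k : ℕ, ((q : ℝ≥0∞) / 2) ^ k ≠ ∞ := by
    rw [ENNReal.tsum_geometric]
    refine ENNReal.inv_ne_top.2 (tsub_pos_of_lt ?_).ne'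
    rw [ENNReal.div_lt_iff (by simp) (by simp), one_mul]
    exact_mod_cast hq2
  set A : ℝ≥0∞ := ENNReal.ofReal (4 * Real.pi) * C * ∑' k : ℕ, ((q : ℝ≥0∞) / 2) ^ k with hA
  have hAtop : A ≠ ∞ := ENNReal.mul_ne_top (ENNReal.mul_ne_top ENNReal.ofReal_ne_top (by simp)) hsum
  refine ⟨A.toNNReal, fun t ht => ?_⟩
  rw [ENNReal.coe_toNNReal hAtop, hA, ← ENNReal.tsum_mul_left, ← ENNReal.tsum_mul_right]
  refine ENNReal.tsum_le_tsum fun k => ?_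
  have hpk : ((1 : ℝ) / 2) ^ k * t ∈ Ioc (0 : ℝ) 1 := ⟨mul_pos (by positivity) ht.1,
      mul_le_one₀ (pow_le_one₀ (by norm_num) (by norm_num)) ht.1.le ht.2⟩
  have hp1 := pos_of_one_lt_lowerDilation hmono h1 ht
  have hp2 := pos_of_one_lt_lowerDilation hmono h1 hpk
  have hinv : (φ ((1 / 2) ^ k * t) : ℝ≥0∞)⁻¹ ≤ C * q ^ k * (φ t : ℝ≥0∞)⁻¹ := by
    rw [← ENNReal.coe_inv hp1.ne', ← ENNReal.coe_inv hp2.ne']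
    norm_cast
    rw [← div_eq_mul_inv, le_div_iff₀ hp1, inv_mul_le_iff₀ hp2, mul_comm (φ _)]
    exact h t ht k
  calc _ ≤ ENNReal.ofReal (4 * Real.pi * (1 / 2) ^ k) * (C * q ^ k * (φ t : ℝ≥0∞)⁻¹) := by
        gcongr
    _ = _ := by
        rw [ENNReal.ofReal_mul (by positivity), ENNReal.ofReal_pow (by norm_num),
          ENNReal.div_eq_inv_mul, mul_pow, one_div, ENNReal.ofReal_inv_of_pos two_pos,
          ENNReal.ofReal_ofNat]
        ring

/-- The weak type estimate: the iterated norm dominates every value of a function that is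
nonincreasing in each variable, with the weight `∏ φ_j`. -/
lemma prod_mul_le_iterNorm {m : ℕ} {X : Fin m → SymmetricSpace} {φ : Fin m → ℝ → ℝ≥0}
    (hX : ∀ j, (X j).HasFundamentalFunction (φ j)) {H : (Fin m → ℝ) → ℝ≥0∞} (hH : Antitone H)
    {u : Fin m → ℝ} (hu : ∀ j, u j ∈ Ioc (0 : ℝ) 1) :
    (∏ j, (φ j (u j) : ℝ≥0∞)) * H u ≤ iterNorm X H := by
  have key : ∀ l : List (Fin m), ∀ H : (Fin m → ℝ) → ℝ≥0∞, Antitone H → ∀ x,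
      (l.map fun j => (φ j (u j) : ℝ≥0∞)).prod * H (fun i => if i ∈ l then u i else x i) ≤
        alongCoords (fun j => (X j).extNorm) l H x := by
    intro l
    induction l with
    | nil => intro H _ x; simp
    | cons j l ih =>
      intro H hH x
      have hsec : ∀ x, Antitone fun v => H (Function.update x j v) := fun x v w hvw =>
        hH (update_le_update_iff.2 ⟨hvw, fun _ _ => le_rfl⟩)
      -- Taking the norm in one variable keeps monotonicity in the others, so the one dimensional
      -- estimate can be repeated.
      have hanti : Antitone fun x => (X j).extNorm fun v => H (Function.update x j v) := by
        intro x y hxy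
        refine (X j).extNorm_mono (hsec y).measurable.aemeasurable (Eventually.of_forall fun v => ?_)
        exact hH (update_le_update_iff.2 ⟨le_rfl, fun i _ => hxy i⟩)
      refine le_trans ?_ (ih _ hanti x)
      rw [List.map_cons, List.prod_cons, mul_comm (φ j (u j) : ℝ≥0∞), mul_assoc]
      gcongr
      refine le_trans (le_of_eq ?_) ((hX j).mul_le_extNorm (hsec _) (hu j))
      congr 2
      ext i
      by_cases hij : i = j
      · subst hij; simp
      · simp [hij]
  have := key (List.finRange m) H hH 0
  rw [← Fin.prod_univ_def] at this
  simp only [List.mem_finRange, if_true] at this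
  exact this

lemma prod_mul_le_anisoNorm {m : ℕ} {X : Fin m → SymmetricSpace} {φ : Fin m → ℝ → ℝ≥0}
    (hX : ∀ j, (X j).HasFundamentalFunction (φ j)) (f : (Fin m → ℝ) → ℂ)
    {u : Fin m → ℝ} (hu : ∀ j, u j ∈ Ioc (0 : ℝ) 1) :
    (∏ j, (φ j (u j) : ℝ≥0∞)) *
        alongCoords (fun j => rearrAt (u j)) (List.finRange m) (fun x => ‖f x‖ₑ) 0 ≤
      anisoNorm X f := by
  rw [← iterRearr_eq_alongCoords]
  exact prod_mul_le_iterNorm hX (iterRearr_antitone fun x => ‖f x‖ₑ) hu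

/-- If iterated rearrangements along dyadic points are bounded by products, then so is the
iterated `kAverage`. -/
lemma alongCoords_kAverage_le_of_rearrAt {m : ℕ} {t : Fin m → ℝ} (ht : ∀ j, 0 < t j)
    {c : Fin m → ℕ → ℝ≥0∞} {A : Fin m → ℝ≥0∞}
    (hA : ∀ j, ∑' k : ℕ, ENNReal.ofReal (4 * Real.pi * (1 / 2) ^ k) * c j k ≤ A j)
    (l : List (Fin m)) (hl : l.Nodup) {G : (Fin m → ℝ) → ℝ≥0∞} (hG : Measurable G)
    (W : ℝ≥0∞) (x : Fin m → ℝ)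
    (h : ∀ k : Fin m → ℕ, alongCoords (fun j => rearrAt ((1 / 2) ^ k j * t j)) l G x ≤
      W * (l.map fun j => c j (k j)).prod) :
    alongCoords (fun j => kAverage (t j)) l G x ≤ W * (l.map A).prod := by
  induction l generalizing G W with
  | nil => simpa using h 0
  | cons j l ih =>
    rw [List.nodup_cons] at hl
    have hm : ∀ k : ℕ, Measurable fun x =>
        rearrAt ((1 / 2) ^ k * t j) fun u => G (Function.update x j u) := fun k =>
      measurable_rearrAt_section hG _ j
    calc alongCoords (fun j => kAverage (t j)) (j :: l) G x
        ≤ alongCoords (fun j => kAverage (t j)) l (fun x => ∑' k : ℕ,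
            ENNReal.ofReal (4 * Real.pi * (1 / 2) ^ k) *
              rearrAt ((1 / 2) ^ k * t j) fun u => G (Function.update x j u)) x :=
          alongCoords_mono (T := fun j => kAverage (t j)) (fun j _ _ => kAverage_mono) l
            (fun x => kAverage_le_tsum_rearrAt (ht j) (measurable_section hG j x)) x
      _ ≤ ∑' k : ℕ, ENNReal.ofReal (4 * Real.pi * (1 / 2) ^ k) *
            alongCoords (fun j => kAverage (t j)) l (fun x =>
              rearrAt ((1 / 2) ^ k * t j) fun u => G (Function.update x j u)) x := by
          refine (alongCoords_kAverage_tsum_le t l (fun k => (hm k).const_mul _) x).trans ?_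
          exact ENNReal.tsum_le_tsum fun k =>
            alongCoords_kAverage_const_mul_le t l ENNReal.ofReal_ne_top (hm k) x
      _ ≤ ∑' k : ℕ, ENNReal.ofReal (4 * Real.pi * (1 / 2) ^ k) *
            (W * c j k * (l.map A).prod) := by
          gcongr with k
          -- The factor `c j k` of the peeled coordinate is absorbed into `W`.
          refine ih hl.2 (hm k) _ fun k' => ?_
          have h1 := h (Function.update k' j k)
          have hne : ∀ i ∈ l, i ≠ j := fun i hi hij => hl.1 (hij ▸ hi)
          rw [alongCoords_cons, List.map_cons, List.prod_cons, ← mul_assoc] at h1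
          rw [alongCoords_congr (T' := fun j => rearrAt ((1 / 2) ^ k' j * t j))
            (fun i hi => by simp [hne i hi])] at h1
          rw [List.map_congr_left (g := fun i => c i (k' i))
            (fun i hi => by simp [hne i hi])] at h1
          simpa using h1
      _ = (∑' k : ℕ, ENNReal.ofReal (4 * Real.pi * (1 / 2) ^ k) * c j k) *
            (W * (l.map A).prod) := by
          rw [← ENNReal.tsum_mul_right]
          exact tsum_congr fun k => by ring
      _ ≤ A j * (W * (l.map A).prod) := by gcongr; exact hA j
      _ = _ := by rw [List.map_cons, List.prod_cons]; ring

/-- The iterated `kAverage` is dominated by the anisotropic norm. -/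
lemma alongCoords_kAverage_le_anisoNorm {m : ℕ} {X : Fin m → SymmetricSpace}
    {φ : Fin m → ℝ → ℝ≥0} (hX : ∀ j, (X j).HasFundamentalFunction (φ j))
    (hpos : ∀ j, ∀ t ∈ Ioc (0 : ℝ) 1, 0 < φ j t) {A : Fin m → ℝ≥0}
    (hA : ∀ j, ∀ t ∈ Ioc (0 : ℝ) 1,
      ∑' k : ℕ, ENNReal.ofReal (4 * Real.pi * (1 / 2) ^ k) * (φ j ((1 / 2) ^ k * t) : ℝ≥0∞)⁻¹ ≤
        A j * (φ j t : ℝ≥0∞)⁻¹)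
    {f : (Fin m → ℝ) → ℂ} {G : (Fin m → ℝ) → ℝ≥0∞} (hG : Measurable G)
    (hGf : ∀ᵐ x ∂boxMeasure m, G x = ‖f x‖ₑ)
    {t : Fin m → ℝ} (ht : ∀ j, t j ∈ Ioc (0 : ℝ) 1) :
    alongCoords (fun j => kAverage (t j)) (List.finRange m) G 0 ≤
      (∏ j, (A j : ℝ≥0∞)) * (∏ j, (φ j (t j) : ℝ≥0∞)⁻¹) * anisoNorm X f := by
  refine (alongCoords_kAverage_le_of_rearrAt (fun j => (ht j).1)
    (c := fun j k => (φ j ((1 / 2) ^ k * t j) : ℝ≥0∞)⁻¹)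
    (A := fun j => A j * (φ j (t j) : ℝ≥0∞)⁻¹) (fun j => hA j _ (ht j))
    _ (List.nodup_finRange m) hG (anisoNorm X f) 0 fun k => ?_).trans ?_
  · have hmem : ∀ j, ((1 : ℝ) / 2) ^ k j * t j ∈ Ioc (0 : ℝ) 1 := fun j =>
      ⟨mul_pos (by positivity) (ht j).1,
        mul_le_one₀ (pow_le_one₀ (by norm_num) (by norm_num)) (ht j).1.le (ht j).2⟩
    have h1 := prod_mul_le_anisoNorm hX f hmem
    -- Iterated rearrangements ignore null sets, so the measurable representative `G` can be
    -- compared with `‖f‖ₑ`.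
    have h2 : alongCoords (fun j => rearrAt ((1 / 2) ^ k j * t j)) (List.finRange m) G 0 ≤
        alongCoords (fun j => rearrAt ((1 / 2) ^ k j * t j)) (List.finRange m)
          (fun x => ‖f x‖ₑ) 0 :=
      alongCoords_ae_mono (T := fun j => rearrAt ((1 / 2) ^ k j * t j))
        (fun j g h hgh => rearrAt_ae_mono hgh _)
        (hGf.mono fun x hx => hx.le) 0
    refine h2.trans ?_
    rw [← Fin.prod_univ_def, ← ENNReal.prod_inv_distrib (fun i _ j _ _ => Or.inr ENNReal.coe_ne_top),
      ← div_eq_mul_inv, ENNReal.le_div_iff_mul_le, mul_comm]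
    · exact h1
    · left
      exact Finset.prod_ne_zero_iff.2 fun j _ => by
        simpa using (hpos j _ (hmem j)).ne'
    · left
      exact ENNReal.prod_ne_top fun j _ => ENNReal.coe_ne_top
  · rw [← Fin.prod_univ_def, Finset.prod_mul_distrib, mul_comm]

end SymmetricSpace

/-! ### A discrete reproducing kernel for trigonometric polynomials -/

section DiscreteKernel

/-- The exponential `e^{icy}`. -/
def expI (c : ℤ) (y : ℝ) : ℂ := Complex.exp (Complex.I * ((c * y : ℝ) : ℂ))

lemma expI_add (c d : ℤ) (y : ℝ) : expI (c + d) y = expI c y * expI d y := by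
  rw [expI, expI, expI, ← Complex.exp_add]
  congr 1; push_cast; ring

lemma norm_expI (c : ℤ) (y : ℝ) : ‖expI c y‖ = 1 := by
  rw [expI, mul_comm]; exact Complex.norm_exp_ofReal_mul_I _

lemma conj_expI (c : ℤ) (y : ℝ) : (starRingEnd ℂ) (expI c y) = expI (-c) y := by
  rw [expI, expI, ← Complex.exp_conj]
  congr 1
  rw [map_mul, Complex.conj_I, Complex.conj_ofReal]; push_cast; ring

/-- A geometric sum over `M`-th roots of unity; `|c| < M` ensures that only `c = 0` is a multiple of
`M`. -/
lemma sum_expI_nodes {M : ℕ} (hM : 0 < M) {c : ℤ} (hc : |c| < M) (θ : ℝ) :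
    ∑ l ∈ Finset.range M, expI c (θ + l * (2 * Real.pi / M)) = if c = 0 then (M : ℂ) else 0 := by
  split_ifs with h0
  · simp [h0, expI]
  have hM' : (M : ℂ) ≠ 0 := by exact_mod_cast hM.ne'
  set z : ℂ := Complex.exp (2 * Real.pi * Complex.I * (c / M)) with hz
  have hterm : ∀ l ∈ Finset.range M,
      expI c (θ + l * (2 * Real.pi / M)) = expI c θ * z ^ l := by
    intro l _
    rw [expI, expI, hz, ← Complex.exp_nat_mul, ← Complex.exp_add]
    congr 1; push_cast; ring
  rw [Finset.sum_congr rfl hterm, ← Finset.mul_sum]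
  have hz1 : z ≠ 1 := by
    rw [hz, Ne, Complex.exp_eq_one_iff]
    rintro ⟨n, hn⟩
    have h2 : (2 * Real.pi * Complex.I : ℂ) ≠ 0 := by
      simp [Real.pi_ne_zero]
    rw [mul_comm (n : ℂ)] at hn
    have h3 := mul_left_cancel₀ h2 hn
    rw [div_eq_iff hM'] at h3
    have h4 : c = n * M := by exact_mod_cast h3
    have hn0 : n ≠ 0 := by rintro rfl; simp at h4; exact h0 h4
    rw [h4, abs_mul, Nat.abs_cast] at hc
    have : 1 ≤ |n| := Int.one_le_abs hn0
    nlinarith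
  have hzM : z ^ M = 1 := by
    rw [hz, ← Complex.exp_nat_mul, Complex.exp_eq_one_iff]
    exact ⟨c, by field_simp⟩
  have : (∑ l ∈ Finset.range M, z ^ l) * (z - 1) = 0 := by rw [geom_sum_mul, hzM, sub_self]
  rcases mul_eq_zero.1 this with h | h
  · rw [h, mul_zero]
  · exact absurd (sub_eq_zero.1 h) hz1

/-- Discrete Parseval: in the expanded square only the diagonal terms survive summation over the
nodes. -/
lemma sum_sq_norm_nodes {M : ℕ} (hM : 0 < M) (S : Finset ℤ)
    (hS : ∀ a ∈ S, ∀ b ∈ S, |a - b| < M) (θ : ℝ) :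
    ∑ l ∈ Finset.range M, ‖∑ a ∈ S, expI a (θ + l * (2 * Real.pi / M))‖ ^ 2 = M * S.card := by
  have h1 : ∀ y : ℝ, ((‖∑ a ∈ S, expI a y‖ ^ 2 : ℝ) : ℂ) = ∑ a ∈ S, ∑ b ∈ S, expI (a - b) y := by
    intro y
    push_cast
    rw [← Complex.mul_conj', map_sum, Finset.sum_mul_sum]
    refine Finset.sum_congr rfl fun a _ => Finset.sum_congr rfl fun b _ => ?_
    rw [conj_expI, ← expI_add, sub_eq_add_neg]
  have h2 : ((∑ l ∈ Finset.range M,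
      ‖∑ a ∈ S, expI a (θ + l * (2 * Real.pi / M))‖ ^ 2 : ℝ) : ℂ) = (M * S.card : ℝ) := by
    push_cast
    have h3 : ∀ l ∈ Finset.range M, ((‖∑ a ∈ S, expI a (θ + l * (2 * Real.pi / M))‖ : ℝ) : ℂ) ^ 2 =
        ∑ a ∈ S, ∑ b ∈ S, expI (a - b) (θ + l * (2 * Real.pi / M)) := fun l _ => by
      rw [← h1]; push_cast; rfl
    rw [Finset.sum_congr rfl h3, Finset.sum_comm]
    have h4 : ∀ a ∈ S, ∑ l ∈ Finset.range M, ∑ b ∈ S, expI (a - b) (θ + l * (2 * Real.pi / M)) =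
        M := by
      intro a ha
      rw [Finset.sum_comm, Finset.sum_congr rfl fun b hb => sum_expI_nodes hM (hS a ha b hb) θ]
      simp [sub_eq_zero, ha]
    rw [Finset.sum_congr rfl h4]
    simp [mul_comm]
  exact_mod_cast h2

/-- A discrete reproducing kernel for trigonometric polynomials of degree less than `N`, with
`4 N` equidistant nodes. -/
lemma exists_reproducing_weights {N : ℕ} (hN : 0 < N) (θ : ℝ) :
    ∃ v : ℕ → ℂ, (∀ l, ‖v l‖ ≤ 1) ∧ ∑ l ∈ Finset.range (4 * N), ‖v l‖ ≤ 2 ∧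
      ∀ k : ℤ, |k| < N →
        ∑ l ∈ Finset.range (4 * N), v l * expI (-k) (θ + l * (2 * Real.pi / (4 * N : ℕ))) = 1 := by
  set M := 4 * N with hM
  have hM0 : 0 < M := by omega
  have hNr : (0 : ℝ) < N := by exact_mod_cast hN
  have hMr : (M : ℝ) = 4 * N := by rw [hM]; push_cast; ring
  -- A de la Vallée-Poussin type kernel: the product of the Dirichlet kernels of `A` and `B`. For
  -- `|k| < N` and `a ∈ A` one has `k - a ∈ B`, so the product has coefficient `N` at each such `k`.
  -- The frequencies `a + b - k` stay below `4 N` in modulus, so no aliasing occurs.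
  set A : Finset ℤ := Finset.Ico 0 N with hA
  set B : Finset ℤ := Finset.Ico (-2 * N) N with hB
  have hAc : (A.card : ℝ) = N := by simp [hA]
  have hBc : (B.card : ℝ) = 3 * N := by
    have : B.card = 3 * N := by rw [hB, Int.card_Ico]; omega
    rw [this]; push_cast; ring
  set y : ℕ → ℝ := fun l => θ + l * (2 * Real.pi / M) with hy
  set DA : ℕ → ℂ := fun l => ∑ a ∈ A, expI a (y l) with hDA
  set DB : ℕ → ℂ := fun l => ∑ b ∈ B, expI b (y l) with hDB
  have hnorm : ∀ l, ‖DA l * DB l / (N * M)‖ = ‖DA l‖ * ‖DB l‖ / (N * M) := by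
    intro l; simp
  refine ⟨fun l => DA l * DB l / (N * M), fun l => ?_, ?_, fun k hk => ?_⟩
  · have h1 : ‖DA l‖ ≤ N := by
      rw [← hAc]
      refine (norm_sum_le _ _).trans (le_of_eq ?_)
      simp [norm_expI]
    have h2 : ‖DB l‖ ≤ 3 * N := by
      rw [← hBc]
      refine (norm_sum_le _ _).trans (le_of_eq ?_)
      simp [norm_expI]
    rw [hnorm, div_le_one (by positivity), hMr]
    calc ‖DA l‖ * ‖DB l‖ ≤ N * (3 * N) := by gcongr
      _ ≤ N * (4 * N) := by nlinarith
  · have hPA := sum_sq_norm_nodes hM0 A (fun a ha b hb => by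
      rw [hA, Finset.mem_Ico] at ha hb; rw [abs_lt]; omega) θ
    have hPB := sum_sq_norm_nodes hM0 B (fun a ha b hb => by
      rw [hB, Finset.mem_Ico] at ha hb; rw [abs_lt]; omega) θ
    -- The arithmetic-geometric mean inequality and Parseval give `(N + 3 N) / (2 N) = 2`.
    calc ∑ l ∈ Finset.range M, ‖DA l * DB l / (N * M)‖
        ≤ ∑ l ∈ Finset.range M, (‖DA l‖ ^ 2 + ‖DB l‖ ^ 2) / (2 * (N * M)) := by
          refine Finset.sum_le_sum fun l _ => ?_
          rw [hnorm, div_le_div_iff₀ (by positivity) (by positivity)]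
          have : 0 ≤ (N * M : ℝ) := by positivity
          nlinarith [sq_nonneg (‖DA l‖ - ‖DB l‖)]
      _ = (M * N + M * (3 * N)) / (2 * (N * M)) := by
          rw [← Finset.sum_div, Finset.sum_add_distrib, hPA, hPB, hAc, hBc]
      _ ≤ 2 := by
          rw [div_le_iff₀ (by positivity)]; linarith
  · have h1 : ∀ l ∈ Finset.range M, DA l * DB l / (N * M) * expI (-k) (y l) =
        (∑ a ∈ A, ∑ b ∈ B, expI (a + b - k) (y l)) / (N * M) := by
      intro l _
      rw [div_mul_eq_mul_div, hDA, hDB, Finset.sum_mul_sum, Finset.sum_mul]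
      congr 1
      refine Finset.sum_congr rfl fun a _ => ?_
      rw [Finset.sum_mul]
      refine Finset.sum_congr rfl fun b _ => ?_
      rw [sub_eq_add_neg, expI_add, expI_add]
    rw [Finset.sum_congr rfl h1, ← Finset.sum_div, Finset.sum_comm]
    rw [abs_lt] at hk
    have h2 : ∀ a ∈ A, ∑ l ∈ Finset.range M, ∑ b ∈ B, expI (a + b - k) (y l) = (M : ℂ) := by
      intro a ha
      rw [Finset.sum_comm, Finset.sum_congr rfl fun b hb => sum_expI_nodes hM0 (?_) θ]
      · rw [hA, Finset.mem_Ico] at ha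
        rw [Finset.sum_eq_single (k - a)]
        · simp
        · intro b _ hb
          rw [if_neg]
          omega
        · intro h
          exact absurd (by rw [hB, Finset.mem_Ico]; omega) h
      · rw [hA, Finset.mem_Ico] at ha
        rw [hB, Finset.mem_Ico] at hb
        rw [abs_lt]; omega
    rw [Finset.sum_congr rfl h2, Finset.sum_const, nsmul_eq_mul]
    have hAc' : (A.card : ℂ) = N := by simp [hA]
    rw [hAc', div_self]
    exact mul_ne_zero (by exact_mod_cast hN.ne') (by exact_mod_cast hM0.ne')

end DiscreteKernel

/-! ### Nikol'skii type inequality: supremum against averages -/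

section Reproduced

variable {m : ℕ}

/-- `G` has period `2π` in the `j`-th variable, and its values are dominated by weighted sums of its
values at `4 N` equidistant points along that variable, for any position of these points. -/
structure ReproducedAlong (j : Fin m) (N : ℕ) (G : (Fin m → ℝ) → ℝ≥0∞) : Prop where
  periodic : ∀ x, G (Function.update x j (x j + 2 * Real.pi)) = G x
  le_sum : ∀ θ : ℝ, ∃ w : ℕ → ℝ≥0, (∀ l, w l ≤ 1) ∧ ∑ l ∈ Finset.range (4 * N), w l ≤ 2 ∧
    ∀ x, G x ≤ ∑ l ∈ Finset.range (4 * N),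
      w l * G (Function.update x j (x j - (θ + l * (2 * Real.pi / (4 * N : ℕ)))))

lemma kAverage_sum_le {t : ℝ} {ι : Type*} (s : Finset ι) {g : ι → ℝ → ℝ≥0∞}
    (hg : ∀ i, Measurable (g i)) :
    kAverage t (fun u => ∑ i ∈ s, g i u) ≤ ∑ i ∈ s, kAverage t (g i) := by
  have := kAverage_tsum_le (t := t) (ι := s) (g := fun i => g i) fun i => hg i
  simpa only [Finset.tsum_subtype s fun i => kAverage t (g i),
    fun u => Finset.tsum_subtype s fun i => g i u] using this

/-- Subadditivity and homogeneity of `kAverage` carry the domination over, so variables can be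
treated one at a time. -/
lemma ReproducedAlong.kAverage {j : Fin m} {N : ℕ} {G : (Fin m → ℝ) → ℝ≥0∞}
    (h : ReproducedAlong j N G) (hG : Measurable G) {i : Fin m} (hij : i ≠ j) (t : ℝ) :
    ReproducedAlong j N fun x => kAverage t fun u => G (Function.update x i u) := by
  constructor
  · intro x
    congr 1
    ext u
    rw [Function.update_comm hij.symm]
    simpa [Function.update_of_ne hij.symm] using h.periodic (Function.update x i u)
  · intro θ
    obtain ⟨w, hw1, hw2, hw⟩ := h.le_sum θ
    refine ⟨w, hw1, hw2, fun x => ?_⟩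
    set y : ℕ → ℝ := fun l => x j - (θ + l * (2 * Real.pi / (4 * N : ℕ))) with hy
    have hm : ∀ l, Measurable fun u => G (Function.update (Function.update x j (y l)) i u) :=
      fun l => measurable_section hG i _
    calc _ ≤ _root_.kAverage t fun u => ∑ l ∈ Finset.range (4 * N),
          (w l : ℝ≥0∞) * G (Function.update (Function.update x j (y l)) i u) := by
          refine kAverage_mono fun u => ?_
          refine (hw _).trans (le_of_eq (Finset.sum_congr rfl fun l _ => ?_))
          rw [Function.update_of_ne hij.symm, Function.update_comm hij]
      _ ≤ ∑ l ∈ Finset.range (4 * N), _root_.kAverage t fun u =>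
          (w l : ℝ≥0∞) * G (Function.update (Function.update x j (y l)) i u) :=
          kAverage_sum_le _ fun l => (hm l).const_mul _
      _ ≤ _ := Finset.sum_le_sum fun l _ => kAverage_const_mul_le ENNReal.coe_ne_top (hm l)

/-- Averaging the position of the nodes over one mesh interval turns a sum over nodes into an
integral over the period. -/
lemma sum_lintegral_translates {k : ℝ → ℝ≥0∞} (hk : Measurable k) {h : ℝ} (hh : 0 ≤ h) (n : ℕ) :
    ∑ l ∈ Finset.range n, ∫⁻ θ in Ico 0 h, k (θ + l * h) = ∫⁻ y in Ico 0 (n * h), k y := by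
  induction n with
  | zero => simp
  | succ n ih =>
    have h1 : ∫⁻ θ in Ico 0 h, k (θ + n * h) = ∫⁻ y in Ico (n * h) ((n + 1) * h), k y := by
      rw [← (measurePreserving_add_right volume (n * h)).setLIntegral_comp_preimage
        measurableSet_Ico hk]
      congr 2
      ext y; simp only [Set.mem_Ico, Set.mem_preimage]
      constructor <;> rintro ⟨h1, h2⟩ <;> constructor <;> linarith
    rw [Finset.sum_range_succ, ih, h1, ← lintegral_union measurableSet_Ico
      (Set.Ico_disjoint_Ico_same), Set.Ico_union_Ico_eq_Ico (by positivity) (by nlinarith)]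
    push_cast; rfl

lemma lintegral_reflect_periodic {g : ℝ → ℝ≥0∞} (hg : Measurable g)
    (hper : Function.Periodic g (2 * Real.pi)) (a : ℝ) :
    ∫⁻ y in Ico 0 (2 * Real.pi), g (a - y) = ∫⁻ y in Ico 0 (2 * Real.pi), g y := by
  have hinv : ∀ (c : AddSubgroup.zmultiples (2 * Real.pi)) (x : ℝ), g (c +ᵥ x) = g x := by
    rintro ⟨c, n, rfl⟩ x
    change g (n • (2 * Real.pi) + x) = g x
    rw [add_comm]
    exact hper.zsmul n x
  have h1 := (Measure.measurePreserving_sub_left volume a).setLIntegral_comp_preimage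
    (measurableSet_Ioc (a := a - 2 * Real.pi) (b := a - 2 * Real.pi + 2 * Real.pi)) hg
  have h2 := (isAddFundamentalDomain_Ioc Real.two_pi_pos (a - 2 * Real.pi)
    (μ := volume)).setLIntegral_eq (isAddFundamentalDomain_Ioc Real.two_pi_pos 0) g hinv
  have h3 : (fun y => a - y) ⁻¹' Ioc (a - 2 * Real.pi) (a - 2 * Real.pi + 2 * Real.pi) =
      Ico 0 (2 * Real.pi) := by
    ext y; simp only [Set.mem_Ico, Set.mem_preimage, Set.mem_Ioc]
    constructor <;> rintro ⟨h1, h2⟩ <;> constructor <;> linarith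
  rw [h3] at h1
  rw [h1, h2, zero_add]
  exact setLIntegral_congr Ioc_ae_eq_Icc |>.trans (setLIntegral_congr Ico_ae_eq_Icc).symm

/-- The one dimensional inequality between the supremum and the averages over sets of measure at
least `1 / N`. -/
lemma ReproducedAlong.le_two_mul_kAverage {j : Fin m} {N : ℕ} (hN : 0 < N)
    {G : (Fin m → ℝ) → ℝ≥0∞} (h : ReproducedAlong j N G) (hG : Measurable G) (x : Fin m → ℝ)
    (a : ℝ) :
    G (Function.update x j a) ≤ 2 * _root_.kAverage (1 / N) fun u => G (Function.update x j u) := by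
  set g : ℝ → ℝ≥0∞ := fun u => G (Function.update x j u) with hgdef
  have hg : Measurable g := measurable_section hG j x
  have hper : Function.Periodic g (2 * Real.pi) := by
    intro u
    simpa using h.periodic (Function.update x j u)
  have hNr : (0 : ℝ) < N := by exact_mod_cast hN
  set s : ℝ := 2 * Real.pi / (4 * N : ℕ) with hs
  have hspos : 0 < s := by rw [hs]; have := Real.pi_pos; push_cast; positivity
  have hsN : ((4 * N : ℕ) : ℝ) * s = 2 * Real.pi := by
    rw [hs]; push_cast; field_simp
  rw [_root_.kAverage.eq_def, ENNReal.mul_iInf fun h => absurd h ENNReal.ofNat_ne_top]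
  refine le_iInf fun q => ?_
  set c := ENNReal.ofReal q with hc
  -- Split each value into the level `c` and its excess: the weights sum to at most 2 on the level,
  -- and each is at most 1 on the excess.
  have hpt : ∀ θ : ℝ, g a ≤ 2 * c + ∑ l ∈ Finset.range (4 * N), (g (a - (θ + l * s)) - c) := by
    intro θ
    obtain ⟨w, hw1, hw2, hw⟩ := h.le_sum θ
    calc g a ≤ ∑ l ∈ Finset.range (4 * N), (w l : ℝ≥0∞) * g (a - (θ + l * s)) := by
          refine (hw _).trans (le_of_eq (Finset.sum_congr rfl fun l _ => ?_))
          simp [hgdef, hs]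
      _ ≤ ∑ l ∈ Finset.range (4 * N), ((w l : ℝ≥0∞) * c + 1 * (g (a - (θ + l * s)) - c)) := by
          gcongr with l
          calc (w l : ℝ≥0∞) * g (a - (θ + l * s))
              ≤ (w l : ℝ≥0∞) * (c + (g (a - (θ + l * s)) - c)) := by gcongr; exact le_add_tsub
            _ ≤ _ := by
              rw [mul_add]; gcongr; exact_mod_cast hw1 l
      _ ≤ _ := by
          rw [Finset.sum_add_distrib, ← Finset.sum_mul]
          simp only [one_mul]
          gcongr
          exact_mod_cast hw2
  have hk : Measurable fun y => g (a - y) - c := (hg.comp (measurable_id.const_sub a)).sub_const c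
  have hint : ENNReal.ofReal s * g a ≤ ENNReal.ofReal s * (2 * c) +
      ∫⁻ u in Ico 0 (2 * Real.pi), (g u - c) := by
    calc ENNReal.ofReal s * g a = ∫⁻ _ in Ico 0 s, g a := by simp [mul_comm]
      _ ≤ ∫⁻ θ in Ico 0 s, (2 * c + ∑ l ∈ Finset.range (4 * N), (g (a - (θ + l * s)) - c)) :=
          lintegral_mono fun θ => hpt θ
      _ = ENNReal.ofReal s * (2 * c) +
          ∑ l ∈ Finset.range (4 * N), ∫⁻ θ in Ico 0 s, (g (a - (θ + l * s)) - c) := by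
          rw [lintegral_add_left measurable_const, lintegral_finsetSum]
          · simp [mul_comm]
          · exact fun l _ => hk.comp (measurable_id.add_const (l * s))
      _ = _ := by
          rw [sum_lintegral_translates hk hspos.le, hsN]
          congr 1
          exact lintegral_reflect_periodic (g := fun u => g u - c) (hg.sub_const c)
            (fun u => by simp only [hper u]) a
  have hs0 : ENNReal.ofReal s ≠ 0 := (ENNReal.ofReal_pos.2 hspos).ne'
  -- The mesh is `s = π / (2 N)`, so `1 / s = 2 N / π ≤ 2 N`.
  have hinv : (ENNReal.ofReal s)⁻¹ ≤ 2 * (ENNReal.ofReal (1 / N))⁻¹ := by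
    rw [← ENNReal.ofReal_inv_of_pos hspos, ← ENNReal.ofReal_inv_of_pos (by positivity),
      ← ENNReal.ofReal_ofNat 2, ← ENNReal.ofReal_mul two_pos.le]
    refine ENNReal.ofReal_le_ofReal ?_
    rw [inv_le_iff_one_le_mul₀ hspos, one_div, inv_inv]
    have : (4 * N : ℝ) * s = 2 * Real.pi := by rw [← hsN]; push_cast; ring
    nlinarith [Real.pi_gt_three]
  calc g a = (ENNReal.ofReal s)⁻¹ * (ENNReal.ofReal s * g a) := by
        rw [← mul_assoc, ENNReal.inv_mul_cancel hs0 ENNReal.ofReal_ne_top, one_mul]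
    _ ≤ (ENNReal.ofReal s)⁻¹ * (ENNReal.ofReal s * (2 * c) +
        ∫⁻ u in Ico 0 (2 * Real.pi), (g u - c)) := by gcongr
    _ = 2 * c + (ENNReal.ofReal s)⁻¹ * ∫⁻ u in Ico 0 (2 * Real.pi), (g u - c) := by
        rw [mul_add, ← mul_assoc, ENNReal.inv_mul_cancel hs0 ENNReal.ofReal_ne_top, one_mul]
    _ ≤ 2 * c + 2 * (ENNReal.ofReal (1 / N))⁻¹ * ∫⁻ u in Ico 0 (2 * Real.pi), (g u - c) := by
        gcongr
    _ = _ := by rw [mul_add, mul_assoc]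

/-- Along a reproduced coordinate the supremum is at most twice `kAverage (1 / N)`, and `kAverage (t
j)` never exceeds the supremum, whatever `t j` is. -/
lemma alongCoords_kAverage_le_two_pow {t τ : Fin m → ℝ} (l : List (Fin m)) (hl : l.Nodup)
    {G : (Fin m → ℝ) → ℝ≥0∞} (hG : Measurable G)
    (h : ∀ j ∈ l, τ j = t j ∨ ∃ N : ℕ, 0 < N ∧ τ j = 1 / N ∧ ReproducedAlong j N G)
    (x : Fin m → ℝ) :
    alongCoords (fun j => kAverage (t j)) l G x ≤
      2 ^ l.length * alongCoords (fun j => kAverage (τ j)) l G x := by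
  induction l generalizing G with
  | nil => simp
  | cons j l ih =>
    rw [List.nodup_cons] at hl
    have hm : Measurable fun x => kAverage (τ j) fun u => G (Function.update x j u) :=
      measurable_kAverage_section hG (τ j) j
    have h1 : ∀ x, (kAverage (t j) fun u => G (Function.update x j u)) ≤
        2 * kAverage (τ j) fun u => G (Function.update x j u) := by
      intro x
      rcases h j (by simp) with h | ⟨N, hN, hτ, hrep⟩
      · rw [h]; exact le_mul_of_one_le_left' one_le_two
      · rw [hτ]
        exact kAverage_le_of_le fun u => hrep.le_two_mul_kAverage hN hG x u
    calc alongCoords (fun j => kAverage (t j)) (j :: l) G x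
        ≤ alongCoords (fun j => kAverage (t j)) l
            (fun x => 2 * kAverage (τ j) fun u => G (Function.update x j u)) x :=
          alongCoords_mono (T := fun j => kAverage (t j)) (fun j _ _ => kAverage_mono) l h1 x
      _ ≤ 2 * alongCoords (fun j => kAverage (t j)) l
            (fun x => kAverage (τ j) fun u => G (Function.update x j u)) x :=
          alongCoords_kAverage_const_mul_le t l ENNReal.ofNat_ne_top hm x
      _ ≤ 2 * (2 ^ l.length * alongCoords (fun j => kAverage (τ j)) l
            (fun x => kAverage (τ j) fun u => G (Function.update x j u)) x) := by
          gcongr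
          refine ih hl.2 hm fun i hi => ?_
          have hij : j ≠ i := fun hji => hl.1 (hji ▸ hi)
          rcases h i (by simp [hi]) with h | ⟨N, hN, hτ, hrep⟩
          · exact Or.inl h
          · exact Or.inr ⟨N, hN, hτ, hrep.kAverage hG hij _⟩
      _ = _ := by
          rw [alongCoords_cons, List.length_cons, pow_succ, ← mul_assoc, mul_comm 2]

end Reproduced

/-! ### Dyadic blocks as trigonometric polynomials -/

section DyadicBlock

variable {m : ℕ}

lemma character_eq_prod (k : Fin m → ℤ) (x : Fin m → ℝ) :
    character k x = ∏ j, expI (k j) (x j) := by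
  simp only [character, expI]
  rw [← Complex.exp_sum, ← Finset.mul_sum]
  push_cast; rfl

lemma character_update (k : Fin m → ℤ) (x : Fin m → ℝ) (j : Fin m) (a : ℝ) :
    character k (Function.update x j (x j + a)) = character k x * expI (k j) a := by
  rw [character_eq_prod, character_eq_prod, ← Finset.mul_prod_erase _ _ (Finset.mem_univ j),
    ← Finset.mul_prod_erase _ (fun i => expI (k i) (x i)) (Finset.mem_univ j)]
  rw [Finset.prod_congr rfl fun i hi => by
    rw [Function.update_of_ne (Finset.ne_of_mem_erase hi)]]
  have : expI (k j) (x j + a) = expI (k j) (x j) * expI (k j) a := by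
    rw [expI, expI, expI, ← Complex.exp_add]
    congr 1; push_cast; ring
  rw [Function.update_self, this]; ring

lemma continuous_character (k : Fin m → ℤ) : Continuous (character k) := by
  unfold character; fun_prop

lemma continuous_dyadicBlock (f : (Fin m → ℝ) → ℂ) (s : Fin m → ℕ) :
    Continuous (dyadicBlock f s) :=
  continuous_finsetSum _ fun k _ => continuous_const.mul (continuous_character k)

/-- All frequencies of the block in the variable `j` are below `2 ^ s j` in modulus, so the discrete
kernel reproduces each term. -/
lemma dyadicBlock_reproducedAlong (f : (Fin m → ℝ) → ℂ) (s : Fin m → ℕ) (j : Fin m) :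
    ReproducedAlong j (2 ^ s j) fun x => ‖dyadicBlock f s x‖ₑ := by
  constructor
  · intro x
    have : dyadicBlock f s (Function.update x j (x j + 2 * Real.pi)) = dyadicBlock f s x := by
      refine Finset.sum_congr rfl fun k _ => ?_
      have h1 : expI (k j) (2 * Real.pi) = 1 := by
        rw [expI, Complex.exp_eq_one_iff]
        exact ⟨k j, by push_cast; ring⟩
      rw [character_update, h1, mul_one]
    rw [this]
  · intro θ
    obtain ⟨v, hv1, hv2, hv⟩ := exists_reproducing_weights (N := 2 ^ s j) (by positivity) θ
    refine ⟨fun l => ‖v l‖₊, fun l => hv1 l, ?_, fun x => ?_⟩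
    · rw [← NNReal.coe_le_coe]
      push_cast
      exact hv2
    set y : ℕ → ℝ := fun l => θ + l * (2 * Real.pi / (4 * 2 ^ s j : ℕ)) with hy
    have hrep : dyadicBlock f s x = ∑ l ∈ Finset.range (4 * 2 ^ s j),
        v l * dyadicBlock f s (Function.update x j (x j - y l)) := by
      simp only [dyadicBlock, Finset.mul_sum]
      rw [Finset.sum_comm]
      refine Finset.sum_congr rfl fun k hk => ?_
      have hkj : |k j| < (2 ^ s j : ℕ) := by
        rw [freqBlock, Fintype.mem_piFinset] at hk
        have := hk j
        rw [Finset.mem_filter, Finset.mem_Ioo] at this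
        rw [abs_lt]; exact_mod_cast this.1
      have h1 : ∀ l, character k (Function.update x j (x j - y l)) =
          character k x * expI (-k j) (y l) := by
        intro l
        rw [sub_eq_add_neg, character_update]
        congr 1
        rw [expI, expI]; congr 2; push_cast; ring
      calc fourierCoef f k * character k x = fourierCoef f k * character k x *
            ∑ l ∈ Finset.range (4 * 2 ^ s j), v l * expI (-k j) (y l) := by
            rw [hv (k j) hkj, mul_one]
        _ = _ := by
            rw [Finset.mul_sum]
            refine Finset.sum_congr rfl fun l _ => ?_
            rw [h1]; ring
    calc ‖dyadicBlock f s x‖ₑ ≤ ∑ l ∈ Finset.range (4 * 2 ^ s j),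
          ‖v l * dyadicBlock f s (Function.update x j (x j - y l))‖ₑ := by
          conv_lhs => rw [hrep]
          exact enorm_sum_le _ _
      _ = _ := Finset.sum_congr rfl fun l _ => by rw [enorm_mul]; rfl

end DyadicBlock

/-! ### Uniqueness of multiple Fourier series -/

section FourierUniqueness

variable {m : ℕ}

/-- The quotient map onto the torus. -/
def toTorus (x : Fin m → ℝ) : UnitAddTorus (Fin m) := fun i => ((x i / (2 * Real.pi) : ℝ) : UnitAddCircle)

lemma continuous_toTorus : Continuous (toTorus (m := m)) := by
  refine continuous_pi fun i => ?_
  exact (AddCircle.continuous_mk' (1 : ℝ)).comp ((continuous_apply i).div_const _)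

lemma mFourier_toTorus (k : Fin m → ℤ) (x : Fin m → ℝ) :
    UnitAddTorus.mFourier k (toTorus x) = character k x := by
  rw [character_eq_prod]
  change ∏ i, fourier (k i) (toTorus x i) = _
  refine Finset.prod_congr rfl fun i _ => ?_
  have hpi : (Real.pi : ℂ) ≠ 0 := by exact_mod_cast Real.pi_ne_zero
  rw [toTorus, fourier_coe_apply, expI]
  congr 1
  push_cast
  field_simp

lemma toTorus_injOn : InjOn (toTorus (m := m)) (Set.univ.pi fun _ => Ico (0 : ℝ) (2 * Real.pi)) := by
  intro x hx y hy hxy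
  ext i
  have h2 := Real.two_pi_pos
  have hmem : ∀ z ∈ Ico (0 : ℝ) (2 * Real.pi), z / (2 * Real.pi) ∈ Ico (0 : ℝ) (0 + 1) := by
    intro z hz
    exact ⟨div_nonneg hz.1 h2.le, by rw [zero_add, div_lt_one h2]; exact hz.2⟩
  have h1 : x i / (2 * Real.pi) = y i / (2 * Real.pi) :=
    (AddCircle.coe_eq_coe_iff_of_mem_Ico (hmem _ (hx i trivial)) (hmem _ (hy i trivial))).1
      (congrFun hxy i)
  field_simp at h1
  exact h1

/-- Integration against `g` is a bounded functional in the uniform norm that vanishes on the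
characters, whose span is dense. -/
lemma integral_mul_comp_toTorus_eq_zero {g : (Fin m → ℝ) → ℂ} (hg : Integrable g (boxMeasure m))
    (h : ∀ k : Fin m → ℤ, ∫ x, g x * character k x ∂boxMeasure m = 0)
    (q : C(UnitAddTorus (Fin m), ℂ)) : ∫ x, g x * q (toTorus x) ∂boxMeasure m = 0 := by
  have hint : ∀ q : C(UnitAddTorus (Fin m), ℂ),
      Integrable (fun x => g x * q (toTorus x)) (boxMeasure m) := fun q =>
    hg.mul_bdd (c := ‖q‖) (q.continuous.comp continuous_toTorus).aestronglyMeasurable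
      (Eventually.of_forall fun x => q.norm_coe_le_norm _)
  let L : C(UnitAddTorus (Fin m), ℂ) →ₗ[ℂ] ℂ :=
    { toFun := fun q => ∫ x, g x * q (toTorus x) ∂boxMeasure m
      map_add' := fun p q => by
        rw [← integral_add (hint p) (hint q)]
        refine integral_congr_ae (Eventually.of_forall fun x => ?_)
        simp [mul_add]
      map_smul' := fun c q => by
        rw [RingHom.id_apply, smul_eq_mul, ← integral_const_mul]
        refine integral_congr_ae (Eventually.of_forall fun x => ?_)
        simp only [ContinuousMap.smul_apply, smul_eq_mul]
        ring }
  have hL : ∀ q, ‖L q‖ ≤ (∫ x, ‖g x‖ ∂boxMeasure m) * ‖q‖ := by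
    intro q
    calc ‖L q‖ ≤ ∫ x, ‖g x * q (toTorus x)‖ ∂boxMeasure m := norm_integral_le_integral_norm _
      _ ≤ ∫ x, ‖g x‖ * ‖q‖ ∂boxMeasure m := by
          refine integral_mono (hint q).norm (hg.norm.mul_const _) fun x => ?_
          simp only [norm_mul]
          gcongr
          exact q.norm_coe_le_norm _
      _ = _ := integral_mul_const _ _
  let L' := L.mkContinuous _ hL
  have hspan : Submodule.span ℂ (range (UnitAddTorus.mFourier (d := Fin m))) ≤ L'.ker := by
    rw [Submodule.span_le]
    rintro _ ⟨k, rfl⟩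
    change ∫ x, g x * UnitAddTorus.mFourier k (toTorus x) ∂boxMeasure m = 0
    simpa only [mFourier_toTorus] using h k
  have := Submodule.topologicalClosure_minimal _ hspan L'.isClosed_ker
  rw [UnitAddTorus.span_mFourier_closure_eq_top] at this
  exact this (Submodule.mem_top (x := q))

/-- Thickened indicators of the image of `K` in the torus are continuous and decrease to its
indicator. Injectivity on the half-open box identifies the limit with the indicator of `K`. -/
lemma setIntegral_compact_eq_zero {g : (Fin m → ℝ) → ℂ} (hg : Integrable g (boxMeasure m))
    (h : ∀ k : Fin m → ℤ, ∫ x, g x * character k x ∂boxMeasure m = 0)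
    {K : Set (Fin m → ℝ)} (hK : IsCompact K)
    (hKs : K ⊆ Set.univ.pi fun _ => Ico (0 : ℝ) (2 * Real.pi)) :
    ∫ x in K, g x ∂boxMeasure m = 0 := by
  set E := toTorus '' K with hE
  have hEc : IsClosed E := (hK.image continuous_toTorus).isClosed
  set δ : ℕ → ℝ := fun n => 1 / ((n : ℝ) + 1) with hδ
  have hδ0 : ∀ n, 0 < δ n := fun n => Nat.one_div_pos_of_nat
  have hlim := thickenedIndicator_tendsto_indicator_closure hδ0
    tendsto_one_div_add_atTop_nhds_zero_nat E
  rw [tendsto_pi_nhds] at hlim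
  let q : ℕ → C(UnitAddTorus (Fin m), ℂ) := fun n =>
    ⟨fun y => ((thickenedIndicator (hδ0 n) E y : ℝ≥0) : ℂ), by fun_prop⟩
  have hconv : Tendsto (fun n => ∫ x, g x * q n (toTorus x) ∂boxMeasure m) atTop
      (𝓝 (∫ x, K.indicator g x ∂boxMeasure m)) := by
    refine tendsto_integral_of_dominated_convergence (fun x => ‖g x‖) (fun n => ?_) hg.norm
      (fun n => Eventually.of_forall fun x => ?_) ?_
    · exact hg.aestronglyMeasurable.mul
        ((q n).continuous.comp continuous_toTorus).aestronglyMeasurable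
    · rw [norm_mul]
      refine mul_le_of_le_one_right (norm_nonneg _) ?_
      change ‖((thickenedIndicator (hδ0 n) E (toTorus x) : ℝ≥0) : ℂ)‖ ≤ 1
      rw [Complex.norm_real, NNReal.norm_eq]
      exact_mod_cast thickenedIndicator_le_one (hδ0 n) E _
    · rw [boxMeasure_eq_restrict, ae_restrict_iff' (MeasurableSet.univ_pi fun _ => measurableSet_Ico)]
      refine Eventually.of_forall fun x hx => ?_
      have h1 : Tendsto (fun n => q n (toTorus x)) atTop
          (𝓝 (((closure E).indicator (fun _ => (1 : ℝ≥0)) (toTorus x) : ℝ≥0) : ℂ)) :=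
        ((Complex.continuous_ofReal.comp NNReal.continuous_coe).tendsto _).comp
          (hlim (toTorus x))
      convert h1.const_mul (g x) using 2
      rw [hEc.closure_eq]
      have hiff : toTorus x ∈ E ↔ x ∈ K := toTorus_injOn.mem_image_iff hKs hx
      by_cases hxK : x ∈ K
      · simp [hxK, hiff.2 hxK]
      · simp [hxK, mt hiff.1 hxK]
  have hz : ∀ n, ∫ x, g x * q n (toTorus x) ∂boxMeasure m = 0 := fun n =>
    integral_mul_comp_toTorus_eq_zero hg h (q n)
  simp_rw [hz] at hconv
  rw [← integral_indicator hK.measurableSet]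
  exact (tendsto_nhds_unique hconv tendsto_const_nhds)

/-- Uniqueness of Fourier series of integrable functions. -/
lemma ae_eq_zero_of_integral_mul_character {g : (Fin m → ℝ) → ℂ}
    (hg : Integrable g (boxMeasure m))
    (h : ∀ k : Fin m → ℤ, ∫ x, g x * character k x ∂boxMeasure m = 0) :
    ∀ᵐ x ∂boxMeasure m, g x = 0 := by
  -- The previous lemma handles only compact sets inside the half-open box, which is therefore
  -- exhausted by closed boxes.
  set I : ℕ → Set (Fin m → ℝ) := fun n =>
    Set.univ.pi fun _ => Icc 0 (2 * Real.pi - 1 / ((n : ℝ) + 1)) with hI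
  have hIc : ∀ n, IsCompact (I n) := fun n => isCompact_univ_pi fun _ => isCompact_Icc
  have hIs : ∀ n, I n ⊆ Set.univ.pi fun _ => Ico (0 : ℝ) (2 * Real.pi) := fun n =>
    Set.pi_mono fun _ _ x hx => ⟨hx.1, hx.2.trans_lt (sub_lt_self _ Nat.one_div_pos_of_nat)⟩
  have hn : ∀ n, ∀ᵐ x ∂(boxMeasure m).restrict (I n), g x = 0 := by
    intro n
    refine ae_eq_zero_of_forall_setIntegral_isCompact_eq_zero hg.restrict fun K hK => ?_
    rw [Measure.restrict_restrict hK.measurableSet]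
    exact setIntegral_compact_eq_zero hg h (hK.inter (hIc n)) (inter_subset_right.trans (hIs n))
  have hU := (ae_restrict_iUnion_iff I fun x => g x = 0).2 hn
  have hsub : (Set.univ.pi fun _ => Ico (0 : ℝ) (2 * Real.pi)) ⊆ ⋃ n, I n := by
    intro x hx
    have hlim : ∀ i : Fin m, ∀ᶠ n : ℕ in atTop, x i ≤ 2 * Real.pi - 1 / ((n : ℝ) + 1) := by
      intro i
      have h1 : 0 < 2 * Real.pi - x i := sub_pos.2 (hx i trivial).2
      filter_upwards [tendsto_one_div_add_atTop_nhds_zero_nat.eventually (gt_mem_nhds h1)] with n hn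
      linarith
    obtain ⟨n, hn⟩ := (eventually_all.2 hlim).exists
    exact Set.mem_iUnion.2 ⟨n, fun i _ => ⟨(hx i trivial).1, hn i⟩⟩
  rw [ae_restrict_iff' (MeasurableSet.iUnion fun n => (hIc n).measurableSet)] at hU
  have hbox : ∀ᵐ x ∂boxMeasure m, x ∈ Set.univ.pi fun _ : Fin m => Ico (0 : ℝ) (2 * Real.pi) := by
    rw [boxMeasure_eq_restrict]
    exact ae_restrict_mem (MeasurableSet.univ_pi fun _ => measurableSet_Ico)
  filter_upwards [hU, hbox] with x hx hxb using hx (hsub hxb)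

end FourierUniqueness

/-! ### Decomposition into dyadic blocks -/

section DyadicDecomposition

variable {m : ℕ}

lemma integral_expI (c : ℤ) :
    ∫ u in Ico (0 : ℝ) (2 * Real.pi), expI c u = if c = 0 then ((2 * Real.pi : ℝ) : ℂ) else 0 := by
  rw [setIntegral_congr_set Ico_ae_eq_Ioc,
    ← intervalIntegral.integral_of_le Real.two_pi_pos.le]
  split_ifs with h
  · simp [h, expI]
  · have hc : Complex.I * c ≠ 0 := mul_ne_zero Complex.I_ne_zero (by exact_mod_cast h)
    have h1 : ∀ u : ℝ, expI c u = Complex.exp (Complex.I * c * u) := fun u => by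
      rw [expI]; congr 1; push_cast; ring
    simp_rw [h1]
    rw [integral_exp_mul_complex hc]
    have h2 : Complex.exp (Complex.I * c * ((2 * Real.pi : ℝ) : ℂ)) = 1 := by
      rw [Complex.exp_eq_one_iff]
      exact ⟨c, by push_cast; ring⟩
    rw [h2]; simp

lemma integral_character (k : Fin m → ℤ) :
    ∫ x, character k x ∂boxMeasure m = if k = 0 then ((2 * Real.pi : ℝ) : ℂ) ^ m else 0 := by
  simp_rw [character_eq_prod]
  rw [boxMeasure, integral_fintype_prod_eq_prod (f := fun i => expI (k i))]
  simp_rw [integral_expI]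
  split_ifs with h
  · simp [h]
  · obtain ⟨i, hi⟩ := Function.ne_iff.1 h
    exact Finset.prod_eq_zero (Finset.mem_univ i) (if_neg hi)

lemma norm_character (k : Fin m → ℤ) (x : Fin m → ℝ) : ‖character k x‖ = 1 := by
  rw [character_eq_prod, norm_prod]
  simp [norm_expI]

lemma character_add (k l : Fin m → ℤ) (x : Fin m → ℝ) :
    character (k + l) x = character k x * character l x := by
  simp only [character_eq_prod, Pi.add_apply, expI_add, Finset.prod_mul_distrib]

lemma fourierCoef_eq (f : (Fin m → ℝ) → ℂ) (k : Fin m → ℤ) :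
    fourierCoef f k =
      ((2 * Real.pi : ℝ) : ℂ)⁻¹ ^ m * ∫ x, f x * character (-k) x ∂boxMeasure m := by
  rw [fourierCoef, boxMeasure_eq_restrict]

lemma integral_mul_character (f : (Fin m → ℝ) → ℂ) (k : Fin m → ℤ) :
    ∫ x, f x * character k x ∂boxMeasure m =
      ((2 * Real.pi : ℝ) : ℂ) ^ m * fourierCoef f (-k) := by
  have : ((2 * Real.pi : ℝ) : ℂ) ≠ 0 := by exact_mod_cast Real.two_pi_pos.ne'
  rw [fourierCoef_eq, neg_neg, ← mul_assoc, ← mul_pow, mul_inv_cancel₀ this, one_pow, one_mul]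

lemma integrable_mul_character {f : (Fin m → ℝ) → ℂ} (hf : Integrable f (boxMeasure m))
    (k : Fin m → ℤ) : Integrable (fun x => f x * character k x) (boxMeasure m) :=
  hf.mul_bdd (c := 1) (continuous_character k).aestronglyMeasurable
    (Eventually.of_forall fun x => (norm_character k x).le)

lemma integral_dyadicBlock_mul_character (f : (Fin m → ℝ) → ℂ) (s : Fin m → ℕ) (k : Fin m → ℤ) :
    ∫ x, dyadicBlock f s x * character (-k) x ∂boxMeasure m =
      if k ∈ freqBlock s then ((2 * Real.pi : ℝ) : ℂ) ^ m * fourierCoef f k else 0 := by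
  have h1 : ∀ x, dyadicBlock f s x * character (-k) x =
      ∑ l ∈ freqBlock s, fourierCoef f l * character (l - k) x := by
    intro x
    rw [dyadicBlock, Finset.sum_mul]
    refine Finset.sum_congr rfl fun l _ => ?_
    rw [mul_assoc, ← character_add, sub_eq_add_neg]
  simp_rw [h1]
  rw [integral_finsetSum]
  · simp_rw [integral_const_mul, integral_character, sub_eq_zero]
    simp [mul_comm]
  · intro l _
    exact ((integrable_const (1 : ℝ)).mono' (continuous_character _).aestronglyMeasurable
      (Eventually.of_forall fun x => (norm_character _ x).le)).const_mul _

/-- Integrating along one variable first. -/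
lemma integral_eq_zero_of_section {F : (Fin m → ℝ) → ℂ} (hF : Integrable F (boxMeasure m))
    (j : Fin m) (h : ∀ᵐ x ∂boxMeasure m,
      ∫ u in Ico (0 : ℝ) (2 * Real.pi), F (Function.update x j u) = 0) :
    ∫ x, F x ∂boxMeasure m = 0 := by
  set ν := (boxMeasure m).prod (volume.restrict (Ico (0 : ℝ) (2 * Real.pi))) with hν
  have hm : Measurable fun p : (Fin m → ℝ) × ℝ => Function.update p.1 j p.2 := measurable_update'
  -- Resampling one coordinate maps the product measure to `2π` times the box measure, so Fubini
  -- applies to the sections.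
  have hmap : ν.map (fun p => Function.update p.1 j p.2) =
      ENNReal.ofReal (2 * Real.pi) • boxMeasure m := by
    refine Measure.ext_of_lintegral _ fun G hG => ?_
    rw [lintegral_map hG hm, lintegral_smul_measure, smul_eq_mul, ← lintegral_lintegral_update hG j,
      hν]
    exact lintegral_prod _ (hG.comp hm).aemeasurable
  have hint : Integrable F (ν.map fun p => Function.update p.1 j p.2) := by
    rw [hmap]; exact hF.smul_measure ENNReal.ofReal_ne_top
  have h1 : ∫ x, F x ∂(ν.map fun p => Function.update p.1 j p.2) = 0 := by
    rw [integral_map hm.aemeasurable hint.aestronglyMeasurable, hν, integral_prod]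
    · exact integral_eq_zero_of_ae h
    · exact hint.comp_measurable hm
  rw [hmap, integral_smul_measure, ENNReal.toReal_ofReal Real.two_pi_pos.le] at h1
  exact (smul_eq_zero.1 h1).resolve_left Real.two_pi_pos.ne'

/-- The character does not depend on `x j`, so it comes out of the vanishing inner integral. -/
lemma fourierCoef_eq_zero {f : (Fin m → ℝ) → ℂ} (hf : Integrable f (boxMeasure m))
    (h0 : HasZeroMeans f) {k : Fin m → ℤ} {j : Fin m} (hk : k j = 0) : fourierCoef f k = 0 := by
  rw [fourierCoef_eq, integral_eq_zero_of_section (integrable_mul_character hf _) j, mul_zero]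
  have h1 : ∀ᵐ x ∂boxMeasure m, ∫ u in (0 : ℝ)..(2 * Real.pi), f (Function.update x j u) = 0 := by
    rw [boxMeasure_eq_restrict]; exact ae_restrict_of_ae (h0 j)
  filter_upwards [h1] with x hx
  have h2 : ∀ u, character (-k) (Function.update x j u) = character (-k) x := by
    intro u
    have := character_update (-k) x j (u - x j)
    rw [add_sub_cancel] at this
    rw [this, Pi.neg_apply, hk]
    simp [expI]
  simp_rw [h2]
  rw [integral_mul_const, setIntegral_congr_set Ico_ae_eq_Ioc,
    ← intervalIntegral.integral_of_le Real.two_pi_pos.le, hx, zero_mul]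

lemma mem_freqBlock {s : Fin m → ℕ} {k : Fin m → ℤ} :
    k ∈ freqBlock s ↔ ∀ j, (k j).natAbs < 2 ^ s j ∧ 2 ^ s j ≤ 2 * (k j).natAbs := by
  rw [freqBlock, Fintype.mem_piFinset]
  refine forall_congr' fun j => ?_
  rw [Finset.mem_filter, Finset.mem_Ioo, ← abs_lt, Int.abs_eq_natAbs]
  norm_cast

lemma freqBlock_unique {s s' : Fin m → ℕ} {k : Fin m → ℤ} (h : k ∈ freqBlock s)
    (h' : k ∈ freqBlock s') : s = s' := by
  rw [mem_freqBlock] at h h'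
  have key : ∀ a b n : ℕ, n < 2 ^ a → 2 ^ b ≤ 2 * n → b ≤ a := by
    intro a b n h1 h2
    have : 2 ^ b < 2 ^ (a + 1) := by rw [pow_succ]; omega
    have := (Nat.pow_lt_pow_iff_right (by norm_num)).1 this
    omega
  ext j
  exact le_antisymm (key _ _ _ (h' j).1 (h j).2) (key _ _ _ (h j).1 (h' j).2)

lemma exists_mem_freqBlock {k : Fin m → ℤ} (hk : ∀ j, k j ≠ 0) : ∃ s, k ∈ freqBlock s := by
  refine ⟨fun j => (k j).natAbs.size, mem_freqBlock.2 fun j => ⟨Nat.lt_size_self _, ?_⟩⟩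
  have h1 : 0 < (k j).natAbs.size := Nat.size_pos.2 (Int.natAbs_pos.2 (hk j))
  have h2 : 2 ^ ((k j).natAbs.size - 1) ≤ (k j).natAbs := Nat.lt_size.1 (by omega)
  calc 2 ^ (k j).natAbs.size = 2 * 2 ^ ((k j).natAbs.size - 1) := by
        rw [← pow_succ', Nat.sub_add_cancel h1]
    _ ≤ _ := by omega

lemma dyadicBlock_eq_zero (f : (Fin m → ℝ) → ℂ) {s : Fin m → ℕ} {j : Fin m} (hs : s j = 0) :
    dyadicBlock f s = 0 := by
  have : freqBlock s = ∅ := by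
    rw [Finset.eq_empty_iff_forall_notMem]
    intro k hk
    have := mem_freqBlock.1 hk j
    rw [hs, pow_zero] at this
    omega
  ext x
  simp [dyadicBlock, this]

/-- If the dyadic blocks are absolutely summable in the mean, then their sum is the function. -/
lemma ae_enorm_le_tsum_dyadicBlock {f : (Fin m → ℝ) → ℂ} (hf : Integrable f (boxMeasure m))
    (h0 : HasZeroMeans f)
    (hsum : ∑' s : Fin m → ℕ, ∫⁻ x, ‖dyadicBlock f s x‖ₑ ∂boxMeasure m ≠ ∞) :
    ∀ᵐ x ∂boxMeasure m, ‖f x‖ₑ ≤ ∑' s : Fin m → ℕ, ‖dyadicBlock f s x‖ₑ := by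
  set F : (Fin m → ℝ) → ℂ := fun x => ∑' s : Fin m → ℕ, dyadicBlock f s x with hF
  have hFle : ∀ x, ‖F x‖ₑ ≤ ∑' s : Fin m → ℕ, ‖dyadicBlock f s x‖ₑ := fun x =>
    enorm_tsum_le_tsum_enorm
  have hFm : Measurable F := Measurable.tsum fun s => (continuous_dyadicBlock f s).measurable
  have hFint : Integrable F (boxMeasure m) := by
    refine ⟨hFm.aestronglyMeasurable, ?_⟩
    refine (lintegral_mono hFle).trans_lt ?_
    rw [lintegral_tsum fun s => (continuous_dyadicBlock f s).measurable.enorm.aemeasurable]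
    exact hsum.lt_top
  -- A frequency without zero components lies in exactly one block; the other coefficients vanish by
  -- the zero means.
  have hcoef : ∀ k : Fin m → ℤ, ∫ x, (f x - F x) * character k x ∂boxMeasure m = 0 := by
    intro k
    obtain ⟨k, rfl⟩ : ∃ k', k = -k' := ⟨-k, (neg_neg k).symm⟩
    simp_rw [sub_mul]
    rw [integral_sub (integrable_mul_character hf _) (integrable_mul_character hFint _),
      integral_mul_character, neg_neg]
    have h1 : ∀ x, F x * character (-k) x =
        ∑' s : Fin m → ℕ, dyadicBlock f s x * character (-k) x := fun x => tsum_mul_right.symm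
    simp_rw [h1]
    rw [integral_tsum]
    · simp_rw [integral_dyadicBlock_mul_character]
      by_cases hk : ∀ j, k j ≠ 0
      · obtain ⟨s, hs⟩ := exists_mem_freqBlock hk
        rw [tsum_eq_single s fun s' hs' => if_neg fun h => hs' (freqBlock_unique h hs), if_pos hs,
          sub_self]
      · push Not at hk
        obtain ⟨j, hj⟩ := hk
        simp [fourierCoef_eq_zero hf h0 hj]
    · exact fun s => ((continuous_dyadicBlock f s).mul
        (continuous_character _)).aestronglyMeasurable
    · have h2 : ∀ s x, ‖dyadicBlock f s x * character (-k) x‖ₑ = ‖dyadicBlock f s x‖ₑ := by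
        intro s x
        rw [enorm_mul, ← ofReal_norm (character _ _), norm_character, ENNReal.ofReal_one, mul_one]
      simp_rw [h2]
      exact hsum
  filter_upwards [ae_eq_zero_of_integral_mul_character (hf.sub hFint) hcoef] with x hx
  rw [Pi.sub_apply, sub_eq_zero] at hx
  rw [hx]
  exact hFle x

/-- The iterated `kAverage` of a function with zero means is dominated by those of its dyadic
blocks. -/
lemma alongCoords_kAverage_le_tsum_dyadicBlock {f : (Fin m → ℝ) → ℂ}
    (hf : Integrable f (boxMeasure m)) (h0 : HasZeroMeans f) {t : Fin m → ℝ}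
    (ht : ∀ j, t j ∈ Ioc (0 : ℝ) 1) :
    alongCoords (fun j => kAverage (t j)) (List.finRange m) (fun x => ‖f x‖ₑ) 0 ≤
      ∑' s : Fin m → ℕ, alongCoords (fun j => kAverage (t j)) (List.finRange m)
        (fun x => ‖dyadicBlock f s x‖ₑ) 0 := by
  have hmeas : ∀ s, Measurable fun x => ‖dyadicBlock f s x‖ₑ := fun s =>
    (continuous_dyadicBlock f s).measurable.enorm
  set a : ℝ≥0∞ := (ENNReal.ofReal (2 * Real.pi))⁻¹ ^ m with ha
  have ha0 : a ≠ 0 := pow_ne_zero _ (ENNReal.inv_ne_zero.2 ENNReal.ofReal_ne_top)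
  by_cases hfin : ∑' s : Fin m → ℕ, alongCoords (fun j => kAverage (t j)) (List.finRange m)
        (fun x => ‖dyadicBlock f s x‖ₑ) 0 = ∞
  · rw [hfin]; exact le_top
  -- Since the iterated `kAverage` dominates the mean, finiteness of the right-hand side gives
  -- summability in L¹.
  have hsum : ∑' s : Fin m → ℕ, ∫⁻ x, ‖dyadicBlock f s x‖ₑ ∂boxMeasure m ≠ ∞ := by
    intro htop
    have h1 : a * ∑' s : Fin m → ℕ, ∫⁻ x, ‖dyadicBlock f s x‖ₑ ∂boxMeasure m ≤
        ∑' s : Fin m → ℕ, alongCoords (fun j => kAverage (t j)) (List.finRange m)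
          (fun x => ‖dyadicBlock f s x‖ₑ) 0 := by
      rw [← ENNReal.tsum_mul_left]
      exact ENNReal.tsum_le_tsum fun s => lintegral_boxMeasure_le (fun j => (ht j).1)
        (fun j => (ht j).2.trans (by linarith [Real.pi_gt_three])) (hmeas s)
    rw [htop, ENNReal.mul_top ha0] at h1
    exact hfin (top_le_iff.1 h1)
  refine (alongCoords_ae_mono (T := fun j => kAverage (t j))
    (fun j _ _ => kAverage_ae_mono) (ae_enorm_le_tsum_dyadicBlock hf h0 hsum) 0).trans ?_
  exact alongCoords_kAverage_tsum_le t _ hmeas 0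

end DyadicDecomposition

/-! ### The estimate for a block and the assembly -/

section Main

variable {m : ℕ}

lemma tsum_le_sum_tsum_indexSet {a : (Fin m → ℕ) → ℝ≥0∞} (ha : ∀ s j, s j = 0 → a s = 0)
    (n : Fin m → ℕ) : ∑' s, a s ≤ ∑ e : Finset (Fin m), ∑' s : indexSet e n, a s := by
  simp_rw [fun e => tsum_subtype (indexSet e n) a]
  rw [← Summable.tsum_finsetSum fun e _ => ENNReal.summable]
  refine ENNReal.tsum_le_tsum fun s => ?_
  by_cases hs : ∀ j, s j ≠ 0
  · have hmem : s ∈ indexSet (Finset.univ.filter fun j => s j ≤ n j) n :=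
      ⟨fun j => Nat.one_le_iff_ne_zero.2 (hs j), fun j hj => by simpa using hj,
        fun j hj => by simpa using hj⟩
    refine le_trans (le_of_eq ?_) (Finset.single_le_sum (fun _ _ => zero_le)
      (Finset.mem_univ (Finset.univ.filter fun j => s j ≤ n j)))
    rw [Set.indicator_of_mem hmem]
  · push Not at hs
    obtain ⟨j, hj⟩ := hs
    rw [ha s j hj]
    exact zero_le

lemma two_zpow_neg_mem (k : ℕ) : (2 : ℝ) ^ (-(k : ℤ)) ∈ Ioc (0 : ℝ) 1 := by
  refine ⟨by positivity, ?_⟩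
  rw [zpow_neg, zpow_natCast]
  exact inv_le_one_of_one_le₀ (one_le_pow₀ one_le_two)

variable {X : Fin m → SymmetricSpace} {φ : Fin m → ℝ → ℝ≥0} {A : Fin m → ℝ≥0}

/-- A function of finite anisotropic norm is integrable. -/
lemma MemAniso.integrable (hX : ∀ j, (X j).HasFundamentalFunction (φ j))
    (hpos : ∀ j, ∀ t ∈ Ioc (0 : ℝ) 1, 0 < φ j t)
    (hA : ∀ j, ∀ t ∈ Ioc (0 : ℝ) 1,
      ∑' k : ℕ, ENNReal.ofReal (4 * Real.pi * (1 / 2) ^ k) * (φ j ((1 / 2) ^ k * t) : ℝ≥0∞)⁻¹ ≤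
        A j * (φ j t : ℝ≥0∞)⁻¹)
    {f : (Fin m → ℝ) → ℂ} (hf : MemAniso X f) : Integrable f (boxMeasure m) := by
  have hfm : AEStronglyMeasurable f (boxMeasure m) := by
    rw [boxMeasure_eq_restrict]; exact hf.aestronglyMeasurable.restrict
  refine ⟨hfm, ?_⟩
  set G : (Fin m → ℝ) → ℝ≥0∞ := fun x => ‖hfm.mk f x‖ₑ with hG
  have hGm : Measurable G := hfm.stronglyMeasurable_mk.measurable.enorm
  have hGf : ∀ᵐ x ∂boxMeasure m, G x = ‖f x‖ₑ := by
    filter_upwards [hfm.ae_eq_mk] with x hx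
    rw [hG, hx]
  have h1 : (1 : ℝ) ∈ Ioc (0 : ℝ) 1 := ⟨one_pos, le_rfl⟩
  have h2 := (lintegral_boxMeasure_le (t := fun _ => 1) (fun _ => one_pos)
    (fun _ => by linarith [Real.pi_gt_three]) hGm).trans
    (alongCoords_kAverage_le_anisoNorm hX hpos hA hGm hGf fun _ => h1)
  have h3 : (∏ j, (A j : ℝ≥0∞)) * (∏ j, (φ j 1 : ℝ≥0∞)⁻¹) * anisoNorm X f < ∞ := by
    refine ENNReal.mul_lt_top (ENNReal.mul_lt_top ?_ ?_) hf.anisoNorm_lt_top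
    · exact ENNReal.prod_lt_top fun j _ => ENNReal.coe_lt_top
    · refine ENNReal.prod_lt_top fun j _ => ENNReal.inv_lt_top.2 ?_
      exact_mod_cast hpos j 1 h1
  rw [HasFiniteIntegral, ← lintegral_congr_ae hGf]
  by_contra htop
  rw [not_lt, top_le_iff] at htop
  rw [htop, ENNReal.mul_top (pow_ne_zero _ (ENNReal.inv_ne_zero.2 ENNReal.ofReal_ne_top))] at h2
  exact absurd h3 (not_lt.2 h2)

/-- The estimate for a single dyadic block. -/
lemma alongCoords_kAverage_dyadicBlock_le (hX : ∀ j, (X j).HasFundamentalFunction (φ j))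
    (hpos : ∀ j, ∀ t ∈ Ioc (0 : ℝ) 1, 0 < φ j t)
    (hA : ∀ j, ∀ t ∈ Ioc (0 : ℝ) 1,
      ∑' k : ℕ, ENNReal.ofReal (4 * Real.pi * (1 / 2) ^ k) * (φ j ((1 / 2) ^ k * t) : ℝ≥0∞)⁻¹ ≤
        A j * (φ j t : ℝ≥0∞)⁻¹)
    (f : (Fin m → ℝ) → ℂ) {t : Fin m → ℝ} (ht : ∀ j, t j ∈ Ioc (0 : ℝ) 1)
    (e : Finset (Fin m)) (s : Fin m → ℕ) :
    alongCoords (fun j => kAverage (t j)) (List.finRange m) (fun x => ‖dyadicBlock f s x‖ₑ) 0 ≤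
      (2 ^ m * ∏ j, (A j : ℝ≥0∞)) * ((∏ j ∈ eᶜ, (φ j (t j) : ℝ≥0∞)⁻¹) *
        ((∏ j ∈ e, (φ j ((2 : ℝ) ^ (-(s j : ℤ))) : ℝ≥0∞)⁻¹) * anisoNorm X (dyadicBlock f s))) := by
  classical
  -- For `j ∈ e` the new scale is `1 / N` with `N = 2 ^ s j`, the degree bound of the block.
  set τ : Fin m → ℝ := fun j => if j ∈ e then (2 : ℝ) ^ (-(s j : ℤ)) else t j with hτ
  have hτ1 : ∀ j, τ j ∈ Ioc (0 : ℝ) 1 := by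
    intro j
    simp only [hτ]
    split_ifs
    · exact two_zpow_neg_mem _
    · exact ht j
  have hm : Measurable fun x => ‖dyadicBlock f s x‖ₑ :=
    (continuous_dyadicBlock f s).measurable.enorm
  have h1 := alongCoords_kAverage_le_two_pow (t := t) (τ := τ) (List.finRange m)
    (List.nodup_finRange m) hm (fun j _ => by
      by_cases hj : j ∈ e
      · refine Or.inr ⟨2 ^ s j, by positivity, ?_, dyadicBlock_reproducedAlong f s j⟩
        simp [hτ, hj]
      · exact Or.inl (by simp [hτ, hj])) 0
  have h2 := alongCoords_kAverage_le_anisoNorm hX hpos hA hm (Eventually.of_forall fun _ => rfl) hτ1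
  have h3 : ∏ j, (φ j (τ j) : ℝ≥0∞)⁻¹ = (∏ j ∈ eᶜ, (φ j (t j) : ℝ≥0∞)⁻¹) *
      ∏ j ∈ e, (φ j ((2 : ℝ) ^ (-(s j : ℤ))) : ℝ≥0∞)⁻¹ := by
    rw [← Finset.prod_compl_mul_prod e]
    congr 1
    · exact Finset.prod_congr rfl fun j hj => by simp [hτ, Finset.mem_compl.1 hj]
    · exact Finset.prod_congr rfl fun j hj => by simp [hτ, hj]
  rw [List.length_finRange] at h1
  refine h1.trans ((mul_le_mul' le_rfl h2).trans (le_of_eq ?_))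
  rw [h3]
  ring

lemma supAverage_le_sum (hX : ∀ j, (X j).HasFundamentalFunction (φ j))
    (hpos : ∀ j, ∀ t ∈ Ioc (0 : ℝ) 1, 0 < φ j t)
    (hA : ∀ j, ∀ t ∈ Ioc (0 : ℝ) 1,
      ∑' k : ℕ, ENNReal.ofReal (4 * Real.pi * (1 / 2) ^ k) * (φ j ((1 / 2) ^ k * t) : ℝ≥0∞)⁻¹ ≤
        A j * (φ j t : ℝ≥0∞)⁻¹)
    {f : (Fin m → ℝ) → ℂ} (hf : MemAniso X f) (h0 : HasZeroMeans f) (n : Fin m → ℕ)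
    {t : Fin m → ℝ} (ht : ∀ j, t j ∈ Ioc (0 : ℝ) 1) :
    supAverage f t ≤ (2 ^ m * ∏ j, (A j : ℝ≥0∞)) *
      ∑ e : Finset (Fin m), (∏ j ∈ eᶜ, (φ j (t j) : ℝ≥0∞)⁻¹) *
        ∑' s : indexSet e n, (∏ j ∈ e, (φ j ((2 : ℝ) ^ (-(s.1 j : ℤ))) : ℝ≥0∞)⁻¹) *
          anisoNorm X (dyadicBlock f s) := by
  refine (supAverage_le_kAverage f fun j => (ht j).1).trans ?_
  refine (alongCoords_kAverage_le_tsum_dyadicBlock (hf.integrable hX hpos hA) h0 ht).trans ?_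
  refine (tsum_le_sum_tsum_indexSet (fun s j hs => ?_) n).trans ?_
  · rw [dyadicBlock_eq_zero f hs]
    have := alongCoords_kAverage_const_mul_le t (List.finRange m) (a := 0) (by simp)
      (G := fun _ => 0) measurable_const 0
    simpa using this
  · rw [Finset.mul_sum]
    refine Finset.sum_le_sum fun e _ => ?_
    rw [← ENNReal.tsum_mul_left, ← ENNReal.tsum_mul_left]
    exact ENNReal.tsum_le_tsum fun s =>
      alongCoords_kAverage_dyadicBlock_le hX hpos hA f ht e s

end Main

end

theorem theorem1 {m : ℕ} (φ : Fin m → ℝ → ℝ≥0)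
    (hφ : ∀ j, 1 < lowerDilation (φ j) ∧ lowerDilation (φ j) ≤ upperDilation (φ j) ∧
      upperDilation (φ j) < 2) :
    ∃ C : ℝ≥0, 0 < C ∧
      ∀ X : Fin m → SymmetricSpace, (∀ j, (X j).HasFundamentalFunction (φ j)) →
      ∀ f : (Fin m → ℝ) → ℂ, MemAniso X f → HasZeroMeans f →
      ∀ n : Fin m → ℕ, (∀ j, 1 ≤ n j) →
      ∀ t : Fin m → ℝ, (∀ j, t j ∈ Ioc ((2 : ℝ) ^ (-(n j : ℤ) - 1)) ((2 : ℝ) ^ (-(n j : ℤ)))) →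
        supAverage f t ≤ C *
          ((∏ j, (φ j (t j) : ℝ≥0∞)⁻¹) *
              ∑' s : {s : Fin m → ℕ | ∀ j, n j < s j}, anisoNorm X (dyadicBlock f s) +
            ∑ e : Finset (Fin m), (∏ j ∈ eᶜ, (φ j (t j) : ℝ≥0∞)⁻¹) *
              ∑' s : indexSet e n,
                (∏ j ∈ e, (φ j ((2 : ℝ) ^ (-(s.1 j : ℤ))) : ℝ≥0∞)⁻¹) *
                  anisoNorm X (dyadicBlock f s)) ∧
        supAverage f t ≤ C *
          ((∏ j, (φ j (t j) : ℝ≥0∞)⁻¹) *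
              ∑' s : {s : Fin m → ℕ | ∀ j, n j < s j}, anisoNorm X (dyadicBlock f s) +
            ∑ e : Finset (Fin m), (∏ j ∈ eᶜ, (φ j (t j) : ℝ≥0∞)⁻¹) *
              ∑' s : indexSet e n,
                (∏ j ∈ e, (φ j ((2 : ℝ) ^ (-(n j : ℤ))) : ℝ≥0∞)⁻¹) *
                  anisoNorm X (dyadicBlock f s)) := by
  -- The constant is chosen before the spaces, while monotonicity of `φ j` comes from some space
  -- having it as fundamental function; if there is none, the claim is vacuous.
  by_cases hex : ∃ X : Fin m → SymmetricSpace, ∀ j, (X j).HasFundamentalFunction (φ j)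
  swap
  · exact ⟨1, one_pos, fun X hX => absurd ⟨X, hX⟩ hex⟩
  obtain ⟨X₀, hX₀⟩ := hex
  have hmono : ∀ j, MonotoneOn (φ j) (Icc 0 1) := fun j => (hX₀ j).monotoneOn
  have hpos : ∀ j, ∀ t ∈ Ioc (0 : ℝ) 1, 0 < φ j t := fun j t ht =>
    pos_of_one_lt_lowerDilation (hmono j) (hφ j).1 ht
  choose A hA using fun j => exists_tsum_inv_bound (hmono j) (hφ j).1 (hφ j).2.2
  refine ⟨2 ^ m * ∏ j, A j + 1, by positivity, fun X hX f hf h0 n _ t ht => ?_⟩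
  have ht' : ∀ j, t j ∈ Ioc (0 : ℝ) 1 := fun j =>
    ⟨lt_trans (by positivity) (ht j).1, (ht j).2.trans (two_zpow_neg_mem _).2⟩
  have hmain := supAverage_le_sum hX hpos hA hf h0 n ht'
  have hC : (2 ^ m * ∏ j, (A j : ℝ≥0∞)) ≤ ((2 ^ m * ∏ j, A j + 1 : ℝ≥0) : ℝ≥0∞) := by
    push_cast
    exact le_self_add
  refine ⟨hmain.trans (mul_le_mul' hC le_add_self),
    hmain.trans (mul_le_mul' hC (le_trans ?_ le_add_self))⟩
  -- The second bound follows termwise: `s j ≤ n j` on `e` gives `φ j (2^{-n_j}) ≤ φ j (2^{-s_j})`.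
  refine Finset.sum_le_sum fun e _ => mul_le_mul' le_rfl (ENNReal.tsum_le_tsum fun s =>
    mul_le_mul' (Finset.prod_le_prod' fun j hj => ?_) le_rfl)
  refine ENNReal.inv_le_inv.2 (ENNReal.coe_le_coe.2 ?_)
  refine hmono j (Ioc_subset_Icc_self (two_zpow_neg_mem _))
    (Ioc_subset_Icc_self (two_zpow_neg_mem _)) ?_
  have := s.2.2.1 j hj
  exact zpow_le_zpow_right₀ one_le_two (by omega)
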